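/- Let $H,U$ be real Hilbert spaces, $0<\alpha\le 1$, $n\ge 0$ and $0=t_0<t_1<\dots<t_n<t_{n+1}=b$. Let $A$ generate a $C_0$-semigroup $\{S(t)\}_{t\ge 0}$ on $H$, let $B,E_1,\dots,E_n\in\mathcal L(U,H)$ and $D_1,\dots,D_n\in\mathcal L(H)$, and consider the fractional impulsive control system $$ {}^{C}D^{\alpha}_{t_k^+}x(t)=Ax(t)+Bu(t)\quad (t\in[0,b]\setminus\{t_1,\dots,t_n\}),\qquad \Delta x(t_k)=D_kx(t_k)+E_kv_k\quad(k=1,\dots,n),\qquad x(0)=x_0, $$ with controls $u\in L^2([0,b],U)$ and $v=(v_1,\dots,v_n)\in U^n$. For $0<\alpha<1$ put $$ \Psi_\alpha(\theta)=\sum_{m=0}^\infty\frac{(-\theta)^m}{m!\,\Gamma(1-\alpha-\alpha m)},\qquad \mathcal S_\alpha(t)=\int_0^\infty\Psi_\alpha(\theta)S(t^\alpha\theta)\,d\theta,\qquad \mathcal P_\alpha(t)=\int_0^\infty\alpha\theta\,\Psi_\alpha(\theta)S(t^\alpha\theta)\,d\theta $$ (strong integrals), and put $\mathcal S_1(t)=\mathcal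 P_1(t)=S(t)$. The mild solution is given by $$ x(t)=\mathcal S_\alpha(t-t_k)x(t_k^+)+\int_{t_k}^t(t-s)^{\alpha-1}\mathcal P_\alpha(t-s)Bu(s)\,ds\qquad(t_k<t\le t_{k+1},\ k=0,\dots,n), $$ where $x(t_0^+)=x_0$ and $x(t_k^+)=(I+D_k)x(t_k)+E_kv_k$ for $k=1,\dots,n$. Let $\mathcal M(u,v)=x(b)$ be its final value for $x_0=0$; here $(u,v)$ ranges over all $u\in L^2([0,b],U)$, $v\in U^n$ for which the integrals $\int_{t_k}^{t_{k+1}}(t_{k+1}-s)^{\alpha-1}\mathcal P_\alpha(t_{k+1}-s)Bu(s)\,ds$, $k=0,\dots,n$, converge absolutely (which is no restriction if $\alpha>\tfrac12$). The system is called approximately controllable on $[0,b]$ if $\overline{\operatorname{Im}\mathcal M}=H$. Assume that $A:H\to H$ is a bounded linear operator defined on all of $H$. If $$ \overline{\operatorname{span}\{A^mBw:\ m=0,1,2,\dots,\ w\in U\}}=H, $$ then the system is approximately controllable on $[0,b]$. -/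

import Mathlib

open Filter Topology MeasureTheory

/-- The Wright function `Ψ_α(θ) = ∑ₙ (-θ)ⁿ / (n! Γ(1 - α - α n))`, used for `0 < α < 1` and
real `θ`.  Since `Real.Gamma` is `0` at the poles of `Γ`, the inverse is `1 / Γ = 0` there,
which is the usual convention. -/
noncomputable def wrightFunction (α θ : ℝ) : ℝ :=
  ∑' n : ℕ, (-θ) ^ n * ((n.factorial : ℝ) * Real.Gamma (-α * n + 1 - α))⁻¹

/-- A strongly continuous semigroup `{S(t)}_{t ≥ 0}` of bounded operators
(values at negative times are irrelevant). -/
structure C0Semigroup (H : Type*) [NormedAddCommGroup H] [InnerProductSpace ℝ H] where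
  /-- the operators of the semigroup -/
  op : ℝ → H →L[ℝ] H
  op_zero : op 0 = ContinuousLinearMap.id ℝ H
  op_add : ∀ s t : ℝ, 0 ≤ s → 0 ≤ t → op (s + t) = (op s).comp (op t)
  tendsto_zero : ∀ x : H, Tendsto (fun t : ℝ => op t x) (𝓝[>] 0) (𝓝 x)

namespace C0Semigroup

variable {H : Type*} [NormedAddCommGroup H] [InnerProductSpace ℝ H]

/-- `A` is the infinitesimal generator of `S`: its domain consists of all `x` for which
`lim_{h → 0+} (S(h)x - x) / h` exists, and `A x` is that limit. -/
def IsGenerator (S : C0Semigroup H) (A : H →ₗ.[ℝ] H) : Prop :=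
  ∀ x y : H, (x, y) ∈ A.graph ↔
    Tendsto (fun h : ℝ => h⁻¹ • (S.op h x - x)) (𝓝[>] 0) (𝓝 y)

/-- The operator `𝒮_α(t) = ∫₀^∞ Ψ_α(θ) S(t^α θ) dθ` (strong integral) for `α < 1`;
for `α = 1`, where `Ψ_α` becomes the point mass at `θ = 1`, it is `S(t)`. -/
noncomputable def solS (S : C0Semigroup H) (α t : ℝ) (x : H) : H :=
  if α = 1 then S.op t x
  else ∫ θ in Set.Ioi (0 : ℝ), wrightFunction α θ • S.op (t ^ α * θ) x

/-- The operator `𝒫_α(t) = ∫₀^∞ α θ Ψ_α(θ) S(t^α θ) dθ` (strong integral) for `α < 1`;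
for `α = 1` it is `S(t)`. -/
noncomputable def solP (S : C0Semigroup H) (α t : ℝ) (x : H) : H :=
  if α = 1 then S.op t x
  else ∫ θ in Set.Ioi (0 : ℝ), (α * θ * wrightFunction α θ) • S.op (t ^ α * θ) x

end C0Semigroup

/-- The data of the linear fractional impulsive control system
`ᶜD^α_{t_k+} x(t) = A x(t) + B u(t)` for `t ∈ [0,b] \ {t₁,…,tₙ}`,
`Δx(t_k) = D_k x(t_k) + E_k v_k` for `k = 1,…,n`, with `A` the generator of a
`C₀`-semigroup `S`.  The times are `0 = t₀ < t₁ < … < tₙ < t_{n+1} = b`;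
the impulse operators `D_k, E_k`, `k = 1,…,n`, are stored at the index `k - 1 : Fin n`. -/
structure FractionalImpulsiveSystem (H U : Type*) [NormedAddCommGroup H] [InnerProductSpace ℝ H]
    [NormedAddCommGroup U] [InnerProductSpace ℝ U] (n : ℕ) where
  /-- order of the Caputo derivative -/
  α : ℝ
  α_pos : 0 < α
  α_le_one : α ≤ 1
  /-- final time -/
  b : ℝ
  /-- initial time, impulse times, final time -/
  t : Fin (n + 2) → ℝ
  t_strictMono : StrictMono t
  t_zero : t 0 = 0
  t_last : t (Fin.last (n + 1)) = b
  /-- the principal operator, possibly unbounded -/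
  A : H →ₗ.[ℝ] H
  /-- the semigroup generated by `A` -/
  S : C0Semigroup H
  isGenerator : S.IsGenerator A
  /-- the distributed control operator -/
  B : U →L[ℝ] H
  /-- the impulse operators on the state -/
  D : Fin n → H →L[ℝ] H
  /-- the impulse operators on the discrete controls -/
  E : Fin n → U →L[ℝ] H

namespace FractionalImpulsiveSystem

variable {H U : Type*} [NormedAddCommGroup H] [InnerProductSpace ℝ H]
  [NormedAddCommGroup U] [InnerProductSpace ℝ U] {n : ℕ}

/-- The integrand `(τ - s)^{α-1} 𝒫_α(τ - s) B u(s)` of the variation of constants formula. -/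
noncomputable def kernel (sys : FractionalImpulsiveSystem H U n) (u : ℝ → U) (τ s : ℝ) : H :=
  (τ - s) ^ (sys.α - 1) • sys.S.solP sys.α (τ - s) (sys.B (u s))

/-- The mild solution on `(t_k, t_{k+1}]`, `k = 0,…,n`, with value `y` at `t_k+`:
`x(τ) = 𝒮_α(τ - t_k) y + ∫_{t_k}^τ (τ - s)^{α-1} 𝒫_α(τ - s) B u(s) ds`. -/
noncomputable def segment (sys : FractionalImpulsiveSystem H U n) (u : ℝ → U)
    (k : Fin (n + 1)) (y : H) (τ : ℝ) : H :=
  sys.S.solS sys.α (τ - sys.t k.castSucc) y + ∫ s in (sys.t k.castSucc)..τ, sys.kernel u τ s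

/-- The post-impulse states: `x(t₀+) = x₀` and, for `k = 1,…,n`,
`x(t_k+) = (I + D_k) x(t_k) + E_k v_k`, where `x(t_k)` is the value at `t_k` of the mild solution
on `(t_{k-1}, t_k]`. -/
noncomputable def postState (sys : FractionalImpulsiveSystem H U n) (x₀ : H) (u : ℝ → U)
    (v : Fin n → U) : Fin (n + 1) → H :=
  Fin.induction x₀ fun k y =>
    sys.segment u k.castSucc y (sys.t k.succ.castSucc)
      + sys.D k (sys.segment u k.castSucc y (sys.t k.succ.castSucc)) + sys.E k (v k)

/-- The value `x(b; x₀, u, v)` of the mild solution at the final time. -/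
noncomputable def finalState (sys : FractionalImpulsiveSystem H U n) (x₀ : H) (u : ℝ → U)
    (v : Fin n → U) : H :=
  sys.segment u (Fin.last n) (sys.postState x₀ u v (Fin.last n)) sys.b

/-- The admissible distributed controls: `u ∈ L²([0,b], U)` for which the integrals
`∫_{t_k}^{t_{k+1}} (t_{k+1} - s)^{α-1} 𝒫_α(t_{k+1} - s) B u(s) ds`, `k = 0,…,n`, exist.
(By Cauchy-Schwarz the second requirement restricts `u` only if `α ≤ 1/2`.) -/
def Admissible (sys : FractionalImpulsiveSystem H U n) (u : ℝ → U) : Prop :=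
  MemLp u 2 (volume.restrict (Set.Icc 0 sys.b)) ∧
    ∀ k : Fin (n + 1), IntervalIntegrable (sys.kernel u (sys.t k.succ)) volume
      (sys.t k.castSucc) (sys.t k.succ)

/-- The operator `ℳ(u, v) = x(b; 0, u, v)`. -/
noncomputable def controlMap (sys : FractionalImpulsiveSystem H U n) (u : ℝ → U)
    (v : Fin n → U) : H :=
  sys.finalState 0 u v

/-- Approximate controllability on `[0, b]`: the image of `ℳ` is dense in `H`. -/
def ApproximatelyControllable (sys : FractionalImpulsiveSystem H U n) : Prop :=
  closure {y : H | ∃ (u : ℝ → U) (v : Fin n → U), sys.Admissible u ∧ sys.controlMap u v = y}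
    = Set.univ

end FractionalImpulsiveSystem

/-! Only controls acting on a short interval `(r, b)` after the last impulse are needed. With zero
initial state and `v = 0`, the state stays zero up to time `r`, so the impulses play no role and the
final state is `∫ (b - s)^(α-1) 𝒫_α(b - s) B u(s) ds` over `(r, b)`. These states form a subspace;
let `z` be orthogonal to it. The control `⟪z, 𝒫_α(b - s) B w⟫ w` is bounded, hence admissible for
every `α`, and it yields `∫ (b - s)^(α-1) ⟪z, 𝒫_α(b - s) B w⟫² ds = 0`. By continuity `⟪z, 𝒫_α(t) B
w⟫ = 0` for small `t > 0` (`inner_solP_eq_zero_of_mem_orthogonal`).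

For small `t`, `𝒫_α(t) = ∑ κ_m t^(αm) A^m` with every `κ_m ≠ 0` (`exists_hasSum_solP`). The identity
theorem in the variable `t^α` then gives `⟪z, A^m B w⟫ = 0` for all `m` and `w`, and the span
hypothesis forces `z = 0`.

For `α = 1` the expansion is the exponential series, because a bounded generator gives `S(t) =
exp(tA)` (`op_eq_exp`). For `α < 1` that series is integrated termwise against `αθ Ψ_α(θ)`. This
needs the moments `k! / Γ(1 + αk)` of `Ψ_α` (`integral_pow_mul_wrightFunction`) and its exponential
decay (`exists_wrightFunction_le`). Both follow from `Ψ_α(θ) = π⁻¹ Im ∫ e^σ σ^(α-1) e^(-θσ^α) dσ`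
over the upper half of a Hankel contour, which comes from Hankel's formula for `1 / Γ` applied to
each term of the defining series. -/

/-! ### The Hankel contour in logarithmic coordinates, and integrability along it. -/

/-- Logarithm of the Hankel contour of opening `φ`: the arc `e^{iy}`, `0 ≤ y ≤ φ`,
is run through for `1 - φ ≤ x ≤ 1`, and the ray `x e^{iφ}` for `x ≥ 1`. -/
noncomputable def hankelLog (φ x : ℝ) : ℂ :=
  if x ≤ 1 then (x - 1 + φ) * Complex.I else Real.log x + φ * Complex.I

/-- The weight `w' e^{e^w}` along the contour `w = hankelLog φ`. -/
noncomputable def hankelWeight (φ x : ℝ) : ℂ :=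
  if x ≤ 1 then Complex.I * Complex.exp (Complex.exp ((x - 1 + φ) * Complex.I))
  else (x : ℂ)⁻¹ * Complex.exp (x * Complex.exp (φ * Complex.I))

/-- The integral `∫ e^{e^w} e^{β w} dw` along the contour. -/
noncomputable def hankelIntegral (φ β : ℝ) : ℂ :=
  ∫ x in Set.Ioi (1 - φ), hankelWeight φ x * Complex.exp (β * hankelLog φ x)

lemma measurable_hankelLog (φ : ℝ) : Measurable (hankelLog φ) := by
  unfold hankelLog
  refine Measurable.ite measurableSet_Iic (by fun_prop) ?_
  exact (Complex.measurable_ofReal.comp Real.measurable_log).add_const _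

lemma measurable_hankelWeight (φ : ℝ) : Measurable (hankelWeight φ) := by
  unfold hankelWeight
  refine Measurable.ite measurableSet_Iic (by fun_prop) ?_
  exact (Complex.measurable_ofReal.inv).mul (by fun_prop)

lemma hankelLog_re (φ x : ℝ) : (hankelLog φ x).re = if x ≤ 1 then 0 else Real.log x := by
  unfold hankelLog
  split_ifs <;> simp

lemma hankelLog_im (φ x : ℝ) : (hankelLog φ x).im = if x ≤ 1 then x - 1 + φ else φ := by
  unfold hankelLog
  split_ifs <;> simp

lemma hankelLog_re_nonneg (φ x : ℝ) : 0 ≤ (hankelLog φ x).re := by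
  rw [hankelLog_re]
  split_ifs with h
  · exact le_rfl
  · exact Real.log_nonneg (not_le.mp h).le

lemma norm_hankelWeight_of_le {φ x : ℝ} (hx : x ≤ 1) : ‖hankelWeight φ x‖ ≤ Real.exp 1 := by
  rw [hankelWeight, if_pos hx, norm_mul, Complex.norm_I, one_mul, Complex.norm_exp]
  have h := Complex.re_le_norm (Complex.exp (((x : ℂ) - 1 + φ) * Complex.I))
  have h2 : ‖Complex.exp (((x : ℂ) - 1 + φ) * Complex.I)‖ = 1 := by
    simp [Complex.norm_exp]
  rw [h2] at h
  exact Real.exp_le_exp.mpr h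

lemma norm_hankelWeight_of_lt {φ x : ℝ} (hx : 1 < x) :
    ‖hankelWeight φ x‖ = x⁻¹ * Real.exp (x * Real.cos φ) := by
  rw [hankelWeight, if_neg (not_le.mpr hx), norm_mul, norm_inv, Complex.norm_real,
    Real.norm_of_nonneg (by linarith), Complex.norm_exp, Complex.re_ofReal_mul,
    Complex.exp_ofReal_mul_I_re]

lemma integrableOn_exp_rpow_ray {φ : ℝ} (hφ : Real.cos φ < 0) {a : ℝ} (ha0 : 0 ≤ a) (ha : a < 1)
    (R : ℝ) :
    IntegrableOn (fun x => x⁻¹ * Real.exp (x * Real.cos φ) * Real.exp (R * x ^ a))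
      (Set.Ioi 1) := by
  -- Half of the decay rate is spent on absorbing `R * x ^ a`, which is `o(x)` because `a < 1`.
  refine integrable_of_isBigO_exp_neg (b := -Real.cos φ / 2) (by linarith) ?_ ?_
  · have h1 : ∀ x ∈ Set.Ici (1 : ℝ), x ≠ 0 := fun x hx => by
      have : (1 : ℝ) ≤ x := hx
      linarith
    refine ContinuousOn.mul (ContinuousOn.mul (continuousOn_inv₀.mono h1) (by fun_prop)) ?_
    exact (ContinuousOn.const_mul (continuousOn_id.rpow_const fun x _ => Or.inr ha0) R).rexp
  · have hlim : Tendsto (fun x : ℝ => R * x ^ (a - 1)) atTop (𝓝 0) := by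
      have := (tendsto_rpow_neg_atTop (y := 1 - a) (by linarith)).const_mul R
      simpa using this
    have hpos : 0 < -Real.cos φ / 2 := by linarith
    refine Asymptotics.IsBigO.of_bound 1 ?_
    filter_upwards [hlim.eventually (gt_mem_nhds hpos),
      eventually_ge_atTop 1] with x hx hx1
    have hx0 : 0 < x := by linarith
    rw [Real.norm_of_nonneg (by positivity), Real.norm_of_nonneg (by positivity), one_mul,
      mul_assoc, ← Real.exp_add]
    have h3 : R * x ^ a = (R * x ^ (a - 1)) * x := by
      rw [mul_assoc, ← Real.rpow_add_one hx0.ne', sub_add_cancel]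
    have h4 : R * x ^ a ≤ -Real.cos φ / 2 * x := by
      rw [h3]; gcongr
    calc x⁻¹ * Real.exp (x * Real.cos φ + R * x ^ a)
        ≤ 1 * Real.exp (x * Real.cos φ + R * x ^ a) := by
          gcongr; exact inv_le_one_of_one_le₀ hx1
      _ ≤ _ := by rw [one_mul]; apply Real.exp_le_exp.mpr; linarith

lemma integrableOn_norm_hankelWeight_mul {φ : ℝ} (hφ : Real.cos φ < 0) {a : ℝ} (ha0 : 0 ≤ a)
    (ha : a < 1) (R : ℝ) :
    IntegrableOn (fun x => ‖hankelWeight φ x‖ * Real.exp (R * Real.exp (a * (hankelLog φ x).re)))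
      (Set.Ioi (1 - φ)) := by
  have hm : Measurable
      (fun x => ‖hankelWeight φ x‖ * Real.exp (R * Real.exp (a * (hankelLog φ x).re))) := by
    have h1 := measurable_hankelWeight φ
    have h2 := Complex.measurable_re.comp (measurable_hankelLog φ)
    exact h1.norm.mul (((h2.const_mul a).exp.const_mul R).exp)
  have hsub : Set.Ioi (1 - φ) ⊆ Set.Ioc (1 - φ) 1 ∪ Set.Ioi 1 := fun x hx => by
    rcases le_or_gt x 1 with h | h
    · exact Or.inl ⟨hx, h⟩
    · exact Or.inr h
  refine IntegrableOn.mono_set (IntegrableOn.union ?_ ?_) hsub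
  · refine Measure.integrableOn_of_bounded (M := Real.exp 1 * Real.exp R) (by simp)
      hm.aestronglyMeasurable ?_
    refine (ae_restrict_iff' measurableSet_Ioc).mpr (Eventually.of_forall fun x hx => ?_)
    rw [norm_mul, norm_norm, hankelLog_re, if_pos hx.2]
    simp only [mul_zero, Real.exp_zero, mul_one, Real.norm_eq_abs, Real.abs_exp]
    gcongr
    exact norm_hankelWeight_of_le hx.2
  · refine (integrableOn_exp_rpow_ray hφ ha0 ha R).congr_fun (fun x hx => ?_) measurableSet_Ioi
    have hx' : (1 : ℝ) < x := hx
    simp only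
    rw [norm_hankelWeight_of_lt hx', hankelLog_re, if_neg (not_le.mpr hx'),
      Real.rpow_def_of_pos (by linarith), mul_comm a]

lemma norm_exp_mul_hankelLog (φ β x : ℝ) :
    ‖Complex.exp (β * hankelLog φ x)‖ = Real.exp (β * (hankelLog φ x).re) := by
  rw [Complex.norm_exp, Complex.re_ofReal_mul]

/-- Integrability of the contour integrand against a stretched exponential. -/
lemma integrableOn_hankel_exp {φ : ℝ} (hφ : Real.cos φ < 0) {a : ℝ} (ha0 : 0 < a)
    (ha : a < 1) (β R : ℝ) :
    IntegrableOn (fun x => ‖hankelWeight φ x * Complex.exp (β * hankelLog φ x)‖ *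
      Real.exp (R * Real.exp (a * (hankelLog φ x).re))) (Set.Ioi (1 - φ)) := by
  have hw := measurable_hankelWeight φ
  have hl := measurable_hankelLog φ
  have h2 := Complex.measurable_re.comp hl
  -- The power `e^(β Re w)` is absorbed as well: `β Re w ≤ (|β| / a) (a Re w) ≤ (|β| / a) e^(a Re
  -- w)`, as `Re w ≥ 0`.
  refine (integrableOn_norm_hankelWeight_mul hφ ha0.le ha (|β| / a + R)).mono'
    ((hw.mul (hl.const_mul _).cexp).norm.mul
      ((h2.const_mul a).exp.const_mul R).exp).aestronglyMeasurable
    (Eventually.of_forall fun x => ?_)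
  rw [norm_mul, norm_norm, norm_mul, norm_exp_mul_hankelLog, Real.norm_eq_abs, Real.abs_exp,
    mul_assoc, ← Real.exp_add, add_mul]
  have h0 := hankelLog_re_nonneg φ x
  have h3 := Real.add_one_le_exp (a * (hankelLog φ x).re)
  refine mul_le_mul_of_nonneg_left (Real.exp_le_exp.mpr (add_le_add_left ?_ _)) (norm_nonneg _)
  calc β * (hankelLog φ x).re ≤ |β| * (hankelLog φ x).re := by gcongr; exact le_abs_self β
    _ = |β| / a * (a * (hankelLog φ x).re) := by field_simp
    _ ≤ _ := by gcongr; linarith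

lemma integrableOn_hankel {φ : ℝ} (hφ : Real.cos φ < 0) (β : ℝ) :
    IntegrableOn (fun x => hankelWeight φ x * Complex.exp (β * hankelLog φ x))
      (Set.Ioi (1 - φ)) := by
  have h := integrableOn_hankel_exp hφ (a := 1 / 2) (by norm_num) (by norm_num) β 0
  simp only [zero_mul, Real.exp_zero, mul_one] at h
  refine (integrable_norm_iff ?_).mp h
  exact ((measurable_hankelWeight φ).mul
    ((measurable_hankelLog φ).const_mul _).cexp).aestronglyMeasurable

/-! ### Hankel's formula for the reciprocal Gamma function. -/

/-- The contour integral as arc plus ray. -/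
lemma hankelIntegral_eq {φ : ℝ} (hφ0 : 0 < φ) (hφ : Real.cos φ < 0) (β : ℝ) :
    hankelIntegral φ β =
      (∫ y in (0 : ℝ)..φ, Complex.I *
        Complex.exp (Complex.exp (y * Complex.I) + β * (y * Complex.I))) +
      ∫ x in Set.Ioi (1 : ℝ), (x : ℂ)⁻¹ *
        Complex.exp (x * Complex.exp (φ * Complex.I) + β * (Real.log x + φ * Complex.I)) := by
  have hint := integrableOn_hankel hφ β
  have hsplit : Set.Ioi (1 - φ) = Set.Ioc (1 - φ) 1 ∪ Set.Ioi 1 :=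
    (Set.Ioc_union_Ioi_eq_Ioi (by linarith)).symm
  rw [hankelIntegral]
  rw [hsplit] at hint ⊢
  rw [setIntegral_union (Set.Ioc_disjoint_Ioi le_rfl) measurableSet_Ioi
    hint.left_of_union hint.right_of_union]
  congr 1
  · rw [← intervalIntegral.integral_of_le (by linarith)]
    have h := intervalIntegral.integral_comp_add_right (a := 1 - φ) (b := 1)
      (fun y : ℝ => Complex.I *
        Complex.exp (Complex.exp (y * Complex.I) + β * (y * Complex.I))) (φ - 1)
    rw [show 1 - φ + (φ - 1) = 0 by ring, show 1 + (φ - 1) = φ by ring] at h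
    rw [← h]
    refine intervalIntegral.integral_congr fun x hx => ?_
    rw [Set.uIcc_of_le (by linarith)] at hx
    simp only [hankelWeight, hankelLog, if_pos hx.2]
    rw [Complex.exp_add, mul_assoc]
    push_cast
    ring_nf
  · refine setIntegral_congr_fun measurableSet_Ioi fun x hx => ?_
    have hx' : (1 : ℝ) < x := hx
    simp only [hankelWeight, hankelLog, if_neg (not_le.mpr hx')]
    rw [Complex.exp_add, mul_assoc]

lemma integrableOn_rpow_mul_exp_mul {β x : ℝ} (hβ : 0 < β) (hx : x < 0) :
    IntegrableOn (fun t : ℝ => t ^ (β - 1) * Real.exp (x * t)) (Set.Ioi 0) := by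
  have h := integrableOn_rpow_mul_exp_neg_mul_rpow (p := 1) (s := β - 1) (b := -x) (by linarith)
    one_pos (by linarith)
  simpa using h

/-- The Laplace transform of `t ^ (β - 1)` on the open right half plane. -/
lemma integral_rpow_mul_cexp_neg_mul {β : ℝ} (hβ : 0 < β) {r : ℂ} (hr : 0 < r.re) :
    ∫ t in Set.Ioi (0 : ℝ), ((t ^ (β - 1) : ℝ) : ℂ) * Complex.exp (-(r * t)) =
      (1 / r) ^ (β : ℂ) * Complex.Gamma β := by
  -- The Laplace transform is the complex moment generating function of this measure at `-r`, hence
  -- analytic. The claim is known for real `r`, and the identity theorem on the half plane carries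
  -- it to complex `r`.
  set μ : Measure ℝ := (volume.restrict (Set.Ioi 0)).withDensity
    (fun t => ENNReal.ofReal (t ^ (β - 1))) with hμ
  have hmeas : Measurable (fun t : ℝ => ENNReal.ofReal (t ^ (β - 1))) := by fun_prop
  have hlt : ∀ᵐ t ∂(volume.restrict (Set.Ioi (0 : ℝ))), ENNReal.ofReal (t ^ (β - 1)) < ⊤ :=
    Eventually.of_forall fun t => ENNReal.ofReal_lt_top
  have hform : ∀ z : ℂ, ProbabilityTheory.complexMGF id μ (-z) =
      ∫ t in Set.Ioi (0 : ℝ), ((t ^ (β - 1) : ℝ) : ℂ) * Complex.exp (-(z * t)) := fun z => by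
    rw [ProbabilityTheory.complexMGF, hμ, integral_withDensity_eq_integral_toReal_smul hmeas hlt]
    refine setIntegral_congr_fun measurableSet_Ioi fun t ht => ?_
    have ht' : (0 : ℝ) < t := ht
    simp only [id_eq]
    rw [ENNReal.toReal_ofReal (by positivity), Complex.real_smul, neg_mul]
  have hsub : Set.Iio 0 ⊆ interior (ProbabilityTheory.integrableExpSet id μ) := by
    refine interior_maximal (fun x hx => ?_) isOpen_Iio
    rw [ProbabilityTheory.integrableExpSet, Set.mem_ofPred_eq, hμ,
      integrable_withDensity_iff_integrable_smul' hmeas hlt]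
    refine (integrableOn_rpow_mul_exp_mul hβ hx).congr_fun (fun t ht => ?_) measurableSet_Ioi
    have ht' : (0 : ℝ) < t := ht
    simp only [id_eq]
    rw [ENNReal.toReal_ofReal (by positivity), smul_eq_mul]
  have hU : IsOpen {z : ℂ | 0 < z.re} := isOpen_lt continuous_const Complex.continuous_re
  have hconv : IsPreconnected {z : ℂ | 0 < z.re} := (convex_halfSpace_re_gt 0).isPreconnected
  have hA : AnalyticOnNhd ℂ (fun z => ProbabilityTheory.complexMGF id μ (-z))
      {z : ℂ | 0 < z.re} := fun z hz => by
    have h1 : AnalyticAt ℂ (ProbabilityTheory.complexMGF id μ) (-z) :=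
      ProbabilityTheory.analyticAt_complexMGF (hsub (by simpa using hz))
    exact h1.comp analyticAt_id.neg
  have hB : AnalyticOnNhd ℂ (fun z : ℂ => (1 / z) ^ (β : ℂ) * Complex.Gamma β)
      {z : ℂ | 0 < z.re} := by
    refine DifferentiableOn.analyticOnNhd (fun z hz => ?_) hU
    have hz' : 0 < z.re := hz
    have hz0 : z ≠ 0 := fun h => by simp [h] at hz'
    have hs : 1 / z ∈ Complex.slitPlane := by
      refine Or.inl ?_
      rw [one_div, Complex.inv_re]
      exact div_pos hz' (Complex.normSq_pos.mpr hz0)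
    exact (((differentiableAt_const _).div differentiableAt_id hz0).cpow
      (differentiableAt_const _) hs).mul_const _ |>.differentiableWithinAt
  have hfreq : ∃ᶠ z in 𝓝[≠] (1 : ℂ), ProbabilityTheory.complexMGF id μ (-z) =
      (1 / z) ^ (β : ℂ) * Complex.Gamma β := by
    have htend : Tendsto (fun x : ℝ => (x : ℂ)) (𝓝[>] 1) (𝓝[≠] (1 : ℂ)) := by
      refine tendsto_nhdsWithin_iff.mpr ⟨?_, ?_⟩
      · exact (Complex.continuous_ofReal.tendsto' 1 1 (by simp)).mono_left nhdsWithin_le_nhds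
      · filter_upwards [self_mem_nhdsWithin] with x hx
        have : (1 : ℝ) < x := hx
        simpa using this.ne'
    refine htend.frequently (Eventually.frequently ?_)
    filter_upwards [self_mem_nhdsWithin] with x hx
    have hx' : (0 : ℝ) < x := lt_trans one_pos hx
    rw [hform, ← Complex.integral_cpow_mul_exp_neg_mul_Ioi (by simpa using hβ) hx']
    refine setIntegral_congr_fun measurableSet_Ioi fun t ht => ?_
    have ht' : (0 : ℝ) < t := ht

    rw [Complex.ofReal_cpow ht'.le]
    push_cast
    rfl
  have := hA.eqOn_of_preconnected_of_frequently_eq hB hconv (z₀ := 1) (by simp) hfreq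
  rw [← hform]
  exact this hr

lemma hasSum_cexp_cexp_add (c : ℝ) (w : ℂ) (x : ℝ) :
    HasSum (fun k : ℕ => (((k.factorial : ℝ)⁻¹ * x ^ k : ℝ) : ℂ) * Complex.exp ((c + k : ℝ) * w))
      (Complex.exp (x * Complex.exp w + c * w)) := by
  have h := (NormedSpace.expSeries_div_hasSum_exp (𝔸 := ℂ) (x * Complex.exp w)).mul_right
    (Complex.exp (c * w))
  rw [← Complex.exp_eq_exp_ℂ, ← Complex.exp_add] at h
  convert! h using 2 with k
  rw [mul_pow, ← Complex.exp_nat_mul]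
  push_cast
  rw [add_mul, Complex.exp_add]
  ring

/-- Termwise integration of the series of `e^σ` against `σ^(β-1)` on the arc from `1` to `e^(iφ)`.
-/
lemma hasSum_hankel_arc {β φ : ℝ} (hβ : 0 < β) :
    HasSum (fun k : ℕ => ((k.factorial : ℝ)⁻¹ : ℂ) *
        ((Complex.exp ((β + k : ℝ) * (φ * Complex.I)) - 1) / (β + k : ℝ)))
      (∫ y in (0 : ℝ)..φ, Complex.I *
        Complex.exp (Complex.exp (y * Complex.I) + β * (y * Complex.I))) := by
  have hsum : Summable (fun k : ℕ => (k.factorial : ℝ)⁻¹) := by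
    simpa using Real.summable_pow_div_factorial 1
  have key := intervalIntegral.hasSum_integral_of_dominated_convergence (μ := volume)
    (a := 0) (b := φ)
    (F := fun (k : ℕ) (y : ℝ) => Complex.I * (((k.factorial : ℝ)⁻¹ : ℂ) *
      Complex.exp ((β + k : ℝ) * (y * Complex.I))))
    (f := fun y => Complex.I *
        Complex.exp (Complex.exp (y * Complex.I) + β * (y * Complex.I)))
    (bound := fun k _ => (k.factorial : ℝ)⁻¹)
    (fun k => (by fun_prop : Continuous _).aestronglyMeasurable)
    (fun k => Eventually.of_forall fun y _ => ?_)
    (Eventually.of_forall fun y _ => hsum) intervalIntegrable_const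
    (Eventually.of_forall fun y _ => ?_)
  · convert! key using 2 with k
    have hne : ((β + k : ℝ) : ℂ) ≠ 0 := by
      have : 0 < β + k := by positivity
      exact_mod_cast this.ne'
    have h1 : (fun y : ℝ => Complex.I * (((k.factorial : ℝ)⁻¹ : ℂ) *
        Complex.exp ((β + k : ℝ) * (y * Complex.I)))) = fun y : ℝ =>
        (Complex.I * ((k.factorial : ℝ)⁻¹ : ℂ)) *
          Complex.exp (((β + k : ℝ) * Complex.I) * y) := by
      funext y
      rw [mul_assoc]
      congr 3
      ring
    rw [h1, intervalIntegral.integral_const_mul,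
      integral_exp_mul_complex (mul_ne_zero hne Complex.I_ne_zero)]
    simp only [Complex.ofReal_zero, mul_zero, Complex.exp_zero]
    rw [show ((β + k : ℝ) : ℂ) * Complex.I * φ = (β + k : ℝ) * (φ * Complex.I) by ring]
    field_simp [Complex.I_ne_zero]
  · rw [norm_mul, Complex.norm_I, one_mul, norm_mul, Complex.norm_exp]
    simp
  · have := (hasSum_cexp_cexp_add β (y * Complex.I) 1).mul_left Complex.I
    simpa using this

/-- The same expansion on the radius from `0` to `e^(iφ)`; `β > 0` makes `x^(β-1)` integrable at the
origin. -/
lemma hasSum_hankel_ray {β φ : ℝ} (hβ : 0 < β) :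
    HasSum (fun k : ℕ => ((k.factorial : ℝ)⁻¹ : ℂ) *
        (Complex.exp ((β + k : ℝ) * (φ * Complex.I)) / (β + k : ℝ)))
      (∫ x in Set.Ioc (0 : ℝ) 1, ((x ^ (β - 1) : ℝ) : ℂ) *
        Complex.exp (x * Complex.exp (φ * Complex.I) + β * (φ * Complex.I))) := by
  have hsum : Summable (fun k : ℕ => (k.factorial : ℝ)⁻¹) := by
    simpa using Real.summable_pow_div_factorial 1
  have hint : IntegrableOn (fun x : ℝ => x ^ (β - 1)) (Set.Ioc 0 1) :=
    (intervalIntegrable_iff_integrableOn_Ioc_of_le zero_le_one).mp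
      (intervalIntegral.intervalIntegrable_rpow' (by linarith))
  have key := hasSum_integral_of_dominated_convergence (μ := volume.restrict (Set.Ioc (0 : ℝ) 1))
    (F := fun (k : ℕ) (x : ℝ) => ((x ^ (β - 1) : ℝ) : ℂ) *
      ((((k.factorial : ℝ)⁻¹ * x ^ k : ℝ) : ℂ) *
      Complex.exp ((β + k : ℝ) * (φ * Complex.I))))
    (f := fun x => ((x ^ (β - 1) : ℝ) : ℂ) *
        Complex.exp (x * Complex.exp (φ * Complex.I) + β * (φ * Complex.I)))
    (bound := fun k x => x ^ (β - 1) * (k.factorial : ℝ)⁻¹)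
    (fun k => (by fun_prop : Measurable _).aestronglyMeasurable)
    (fun k => (ae_restrict_iff' measurableSet_Ioc).mpr (Eventually.of_forall fun x hx => ?_))
    (Eventually.of_forall fun x => hsum.mul_left _) ?_
    (Eventually.of_forall fun x => (hasSum_cexp_cexp_add β (φ * Complex.I) x).mul_left _)
  · convert! key using 2 with k
    have hk : 0 < β + k := by positivity
    have h1 : ∀ x ∈ Set.Ioc (0 : ℝ) 1, ((x ^ (β - 1) : ℝ) : ℂ) *
        ((((k.factorial : ℝ)⁻¹ * x ^ k : ℝ) : ℂ) *
          Complex.exp ((β + k : ℝ) * (φ * Complex.I))) =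
        ((x ^ (β + k - 1) : ℝ) : ℂ) * (((k.factorial : ℝ)⁻¹ : ℂ) *
          Complex.exp ((β + k : ℝ) * (φ * Complex.I))) := fun x hx => by
      rw [show β + k - 1 = β - 1 + k by ring, Real.rpow_add hx.1, Real.rpow_natCast]
      push_cast
      ring
    rw [setIntegral_congr_fun measurableSet_Ioc h1, integral_mul_const, integral_complex_ofReal,
      ← intervalIntegral.integral_of_le zero_le_one, integral_rpow (Or.inl (by linarith))]
    rw [Real.one_rpow, sub_add_cancel, Real.zero_rpow hk.ne']
    push_cast
    ring
  · rw [norm_mul, norm_mul, Complex.norm_real, Complex.norm_real, Complex.norm_exp,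
      Real.norm_of_nonneg (Real.rpow_nonneg hx.1.le _),
      Real.norm_of_nonneg (mul_nonneg (by positivity) (pow_nonneg hx.1.le _))]
    have h2 : (((β + k : ℝ) : ℂ) * (φ * Complex.I)).re = 0 := by simp
    rw [h2, Real.exp_zero, mul_one]
    gcongr
    · exact Real.rpow_nonneg hx.1.le _
    · exact mul_le_of_le_one_right (by positivity) (pow_le_one₀ hx.1.le hx.2)
  · simp_rw [tsum_mul_left]
    exact hint.mul_const _

/-- The reflection formula without division by the sine. At integers both sides vanish, since
`Real.Gamma` is `0` at its poles. -/
lemma sin_mul_Gamma {β : ℝ} (hβ : 0 < β) :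
    Real.sin (β * Real.pi) * Real.Gamma β = Real.pi * (Real.Gamma (1 - β))⁻¹ := by
  have h := Real.Gamma_mul_Gamma_one_sub β
  rw [mul_comm Real.pi β] at h
  have hΓ := (Real.Gamma_pos_of_pos hβ).ne'
  rcases eq_or_ne (Real.sin (β * Real.pi)) 0 with h1 | h1
  · rw [h1, div_zero] at h
    simp [h1, (mul_eq_zero.mp h).resolve_left hΓ]
  · have h0 : Real.Gamma (1 - β) ≠ 0 := fun h0 => by
      rw [h0, mul_zero] at h
      exact div_ne_zero Real.pi_ne_zero h1 h.symm
    field_simp at h ⊢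
    linarith

/-- Cauchy's theorem for a sector, read off from the two series: term by term they differ by the
real number `1 / (k! (β + k))`, the contribution of the segment `[0, 1]`. -/
lemma arc_im_eq_ray_im {β φ : ℝ} (hβ : 0 < β) :
    (∫ y in (0 : ℝ)..φ, Complex.I *
        Complex.exp (Complex.exp (y * Complex.I) + β * (y * Complex.I))).im =
      (∫ x in Set.Ioc (0 : ℝ) 1, ((x ^ (β - 1) : ℝ) : ℂ) *
        Complex.exp (x * Complex.exp (φ * Complex.I) + β * (φ * Complex.I))).im := by
  refine (Complex.hasSum_im (hasSum_hankel_arc hβ)).unique ?_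
  convert! Complex.hasSum_im (hasSum_hankel_ray (φ := φ) hβ) using 2 with k
  rw [← Complex.ofReal_inv, Complex.im_ofReal_mul, Complex.im_ofReal_mul, sub_div,
    Complex.sub_im, ← Complex.ofReal_one, ← Complex.ofReal_div, Complex.ofReal_im, sub_zero]

/-- Hankel's formula in the range where the contour collapses. -/
lemma hankelIntegral_im_of_pos {φ : ℝ} (hφ0 : 0 < φ) (hφπ : φ < Real.pi) (hφ : Real.cos φ < 0)
    {β : ℝ} (hβ : 0 < β) :
    (hankelIntegral φ β).im = Real.pi * (Real.Gamma (1 - β))⁻¹ := by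
  have hre : 0 < (-Complex.exp (φ * Complex.I)).re := by
    rw [Complex.neg_re, Complex.exp_ofReal_mul_I_re]
    linarith
  set f : ℝ → ℂ := fun x => ((x ^ (β - 1) : ℝ) : ℂ) *
    Complex.exp (x * Complex.exp (φ * Complex.I) + β * (φ * Complex.I)) with hf
  have hcont : ContinuousOn f (Set.Ioi 0) := by
    refine ContinuousOn.mul (Complex.continuous_ofReal.comp_continuousOn
      (continuousOn_id.rpow_const fun x hx => Or.inl (ne_of_gt hx))) (by fun_prop)
  have hint : IntegrableOn f (Set.Ioi 0) := by
    refine (integrable_norm_iff (hcont.aestronglyMeasurable measurableSet_Ioi)).mp ?_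
    refine (integrableOn_rpow_mul_exp_mul hβ hφ).congr_fun (fun x hx => ?_) measurableSet_Ioi
    have hx' : (0 : ℝ) < x := hx
    simp only [hf, norm_mul, Complex.norm_real, Complex.norm_exp, Complex.add_re,
      Complex.re_ofReal_mul, Complex.exp_ofReal_mul_I_re]
    rw [Real.norm_of_nonneg (by positivity)]
    simp [mul_comm x]
  have hsplit : Set.Ioi (0 : ℝ) = Set.Ioc 0 1 ∪ Set.Ioi 1 :=
    (Set.Ioc_union_Ioi_eq_Ioi zero_le_one).symm
  have hadd : ∫ x in Set.Ioi (0 : ℝ), f x = (∫ x in Set.Ioc (0 : ℝ) 1, f x) +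
      ∫ x in Set.Ioi (1 : ℝ), f x := by
    rw [hsplit] at hint ⊢
    exact setIntegral_union (Set.Ioc_disjoint_Ioi le_rfl) measurableSet_Ioi
      hint.left_of_union hint.right_of_union
  have htail : ∫ x in Set.Ioi (1 : ℝ), (x : ℂ)⁻¹ *
      Complex.exp (x * Complex.exp (φ * Complex.I) + β * (Real.log x + φ * Complex.I)) =
      ∫ x in Set.Ioi (1 : ℝ), f x := by
    refine setIntegral_congr_fun measurableSet_Ioi fun x hx => ?_
    have hx' : (0 : ℝ) < x := lt_trans one_pos hx
    simp only [hf]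
    rw [Real.rpow_sub_one hx'.ne', Real.rpow_def_of_pos hx', mul_add (β : ℂ), ← add_assoc,
      add_right_comm, Complex.exp_add _ ((β : ℂ) * Real.log x)]
    push_cast
    ring_nf
  -- With the arc moved to the radius, the contour is the full ray, a Laplace transform at
  -- `-e^(iφ)`. The phases `e^(iβφ)` and `e^(iβ(π-φ))` multiply to `e^(iβπ)`, so `φ` drops out.
  have hfull : ∫ x in Set.Ioi (0 : ℝ), f x =
      Complex.exp ((β * Real.pi : ℝ) * Complex.I) * (Real.Gamma β : ℂ) := by
    have h1 := integral_rpow_mul_cexp_neg_mul hβ hre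
    have h2 : ∫ x in Set.Ioi (0 : ℝ), f x = Complex.exp (β * (φ * Complex.I)) *
        ∫ t in Set.Ioi (0 : ℝ), ((t ^ (β - 1) : ℝ) : ℂ) *
          Complex.exp (-(-Complex.exp (φ * Complex.I) * t)) := by
      rw [← integral_const_mul]
      refine integral_congr_ae (Eventually.of_forall fun x => ?_)
      simp only [hf]
      rw [Complex.exp_add]
      ring_nf
    have hlog : Complex.log (1 / -Complex.exp (φ * Complex.I)) = (Real.pi - φ : ℝ) * Complex.I := by
      have h3 : 1 / -Complex.exp (φ * Complex.I) =
          Complex.exp ((Real.pi - φ : ℝ) * Complex.I) := by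
        push_cast
        rw [sub_mul, Complex.exp_sub, Complex.exp_pi_mul_I]
        field_simp
      rw [h3, Complex.log_exp]
      · simp; linarith [Real.pi_pos]
      · simp; linarith
    have hne : (1 / -Complex.exp (φ * Complex.I)) ≠ 0 :=
      one_div_ne_zero (neg_ne_zero.mpr (Complex.exp_ne_zero _))
    rw [h2, h1, Complex.cpow_def_of_ne_zero hne, hlog, ← mul_assoc, ← Complex.exp_add,
      Complex.Gamma_ofReal]
    congr 2
    push_cast
    ring
  rw [hankelIntegral_eq hφ0 hφ, Complex.add_im, arc_im_eq_ray_im hβ, htail, ← Complex.add_im,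
    ← hadd, hfull, mul_comm, Complex.im_ofReal_mul, Complex.exp_ofReal_mul_I_im, mul_comm,
    sin_mul_Gamma hβ]

lemma integrableOn_hankel_ray {φ : ℝ} (hφ0 : 0 < φ) (hφ : Real.cos φ < 0) (β : ℝ) :
    IntegrableOn (fun x : ℝ => (x : ℂ)⁻¹ *
      Complex.exp (x * Complex.exp (φ * Complex.I) + β * (Real.log x + φ * Complex.I)))
      (Set.Ioi 1) := by
  refine ((integrableOn_hankel hφ β).mono_set
    (Set.Ioi_subset_Ioi (by linarith : 1 - φ ≤ 1))).congr_fun (fun x hx => ?_) measurableSet_Ioi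
  have hx' : (1 : ℝ) < x := hx
  simp only [hankelWeight, hankelLog, if_neg (not_le.mpr hx')]
  rw [Complex.exp_add, mul_assoc]

/-- Integration by parts: the integrand is the derivative of `e^(e^w + (β-1)w)` along the arc. The
endpoint term at `e^(iφ)` cancels the one from `integral_hankel_ray_add`. -/
lemma integral_hankel_arc_add (φ β : ℝ) :
    (∫ y in (0 : ℝ)..φ, Complex.I *
        Complex.exp (Complex.exp (y * Complex.I) + β * (y * Complex.I))) +
      (β - 1) * (∫ y in (0 : ℝ)..φ, Complex.I *
        Complex.exp (Complex.exp (y * Complex.I) + (β - 1 : ℝ) * (y * Complex.I))) =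
      Complex.exp (Complex.exp (φ * Complex.I) + (β - 1 : ℝ) * (φ * Complex.I)) -
        Complex.exp 1 := by
  rw [← intervalIntegral.integral_const_mul, ← intervalIntegral.integral_add
    (Continuous.intervalIntegrable (by fun_prop) _ _)
    (Continuous.intervalIntegrable (by fun_prop) _ _)]
  have h := intervalIntegral.integral_eq_sub_of_hasDerivAt (a := 0) (b := φ)
    (f := fun y : ℝ => Complex.exp (Complex.exp (y * Complex.I) + (β - 1 : ℝ) * (y * Complex.I)))
    (f' := fun y : ℝ => Complex.I *
        Complex.exp (Complex.exp (y * Complex.I) + β * (y * Complex.I)) +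
      (β - 1) * (Complex.I *
        Complex.exp (Complex.exp (y * Complex.I) + (β - 1 : ℝ) * (y * Complex.I))))
    (fun y _ => ?_) (Continuous.intervalIntegrable (by fun_prop) _ _)
  · rw [h]; simp
  · have h1 : HasDerivAt (fun y : ℝ => (y : ℂ) * Complex.I) Complex.I y := by
      simpa using (Complex.ofRealCLM.hasDerivAt (x := y)).mul_const Complex.I
    convert! (h1.cexp.add (h1.const_mul ((β - 1 : ℝ) : ℂ))).cexp using 1
    simp only [Pi.add_apply]
    rw [show (Complex.exp (y * Complex.I) + β * (y * Complex.I)) =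
      (Complex.exp (y * Complex.I) + (β - 1 : ℝ) * (y * Complex.I)) + y * Complex.I by
        push_cast; ring, Complex.exp_add _ ((y : ℂ) * Complex.I)]
    push_cast
    ring

lemma integral_hankel_ray_add {φ : ℝ} (hφ0 : 0 < φ) (hφ : Real.cos φ < 0) (β : ℝ) :
    (∫ x in Set.Ioi (1 : ℝ), (x : ℂ)⁻¹ *
        Complex.exp (x * Complex.exp (φ * Complex.I) + β * (Real.log x + φ * Complex.I))) +
      (β - 1) * (∫ x in Set.Ioi (1 : ℝ), (x : ℂ)⁻¹ *
        Complex.exp (x * Complex.exp (φ * Complex.I) +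
          (β - 1 : ℝ) * (Real.log x + φ * Complex.I))) =
      -Complex.exp (Complex.exp (φ * Complex.I) + (β - 1 : ℝ) * (φ * Complex.I)) := by
  have hi1 := integrableOn_hankel_ray hφ0 hφ β
  have hi2 := (integrableOn_hankel_ray hφ0 hφ (β - 1)).const_mul ((β : ℂ) - 1)
  rw [← integral_const_mul, ← integral_add hi1 hi2]
  have hd : ∀ x : ℝ, 0 < x → HasDerivAt (fun x : ℝ => Complex.exp (x * Complex.exp (φ * Complex.I) +
      (β - 1 : ℝ) * (Real.log x + φ * Complex.I)))
      ((x : ℂ)⁻¹ *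
        Complex.exp (x * Complex.exp (φ * Complex.I) + β * (Real.log x + φ * Complex.I)) +
      (β - 1) * ((x : ℂ)⁻¹ *
        Complex.exp (x * Complex.exp (φ * Complex.I) +
          (β - 1 : ℝ) * (Real.log x + φ * Complex.I)))) x := fun x hx => by
    have h1 : HasDerivAt (fun x : ℝ => (x : ℂ) * Complex.exp (φ * Complex.I))
        (Complex.exp (φ * Complex.I)) x := by
      simpa using (Complex.ofRealCLM.hasDerivAt (x := x)).mul_const (Complex.exp (φ * Complex.I))
    have h2 : HasDerivAt (fun x : ℝ => (Real.log x : ℂ) + φ * Complex.I) ((x⁻¹ : ℝ) : ℂ) x :=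
      (Real.hasDerivAt_log hx.ne').ofReal_comp.add_const _
    convert! (h1.add (h2.const_mul ((β - 1 : ℝ) : ℂ))).cexp using 1
    simp only [Pi.add_apply]
    have hx0 : (x : ℂ) ≠ 0 := by exact_mod_cast hx.ne'
    have h3 : Complex.exp (Real.log x + φ * Complex.I) = x * Complex.exp (φ * Complex.I) := by
      rw [Complex.exp_add, ← Complex.ofReal_exp, Real.exp_log hx]
    rw [show (x * Complex.exp (φ * Complex.I) + β * (Real.log x + φ * Complex.I)) =
      (x * Complex.exp (φ * Complex.I) + (β - 1 : ℝ) * (Real.log x + φ * Complex.I)) +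
        (Real.log x + φ * Complex.I) by push_cast; ring,
      Complex.exp_add _ ((Real.log x : ℂ) + φ * Complex.I), h3]
    push_cast
    field_simp
  have hlim : Tendsto (fun x : ℝ => Complex.exp (x * Complex.exp (φ * Complex.I) +
      (β - 1 : ℝ) * (Real.log x + φ * Complex.I))) atTop (𝓝 0) := by
    rw [tendsto_zero_iff_norm_tendsto_zero]
    refine (tendsto_rpow_mul_exp_neg_mul_atTop_nhds_zero (β - 1) (-Real.cos φ)
      (by linarith)).congr' ?_
    filter_upwards [eventually_gt_atTop 0] with x hx
    rw [Complex.norm_exp, Complex.add_re, Complex.re_ofReal_mul, Complex.re_ofReal_mul,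
      Complex.exp_ofReal_mul_I_re, Complex.add_re, Complex.ofReal_re, Complex.re_ofReal_mul,
      Complex.I_re, Real.rpow_def_of_pos hx, ← Real.exp_add]
    congr 1
    ring
  rw [integral_Ioi_of_hasDerivAt_of_tendsto (hd 1 one_pos).continuousAt.continuousWithinAt
    (fun x hx => hd x (lt_trans one_pos hx)) (hi1.add hi2) hlim]
  simp

/-- This is the counterpart of `Γ(z + 1) = z Γ(z)`. The only surviving boundary term, `-e` from `σ =
1`, is real. -/
lemma hankelIntegral_im_rec {φ : ℝ} (hφ0 : 0 < φ) (hφ : Real.cos φ < 0) (β : ℝ) :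
    (hankelIntegral φ β).im = (1 - β) * (hankelIntegral φ (β - 1)).im := by
  have h : hankelIntegral φ β = ((1 - β : ℝ) : ℂ) * hankelIntegral φ (β - 1) -
      (Real.exp 1 : ℝ) := by
    rw [hankelIntegral_eq hφ0 hφ, hankelIntegral_eq hφ0 hφ, Complex.ofReal_exp]
    have h1 := integral_hankel_arc_add φ β
    have h2 := integral_hankel_ray_add hφ0 hφ β
    push_cast at h1 h2 ⊢
    linear_combination h1 + h2
  rw [h, Complex.sub_im, Complex.im_ofReal_mul, Complex.ofReal_im, sub_zero]

/-- At `β = 0` the ray integral diverges at the origin, and the recursion at `β = 1` has factor `0`.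
The value is therefore a limit `β → 0+`, dominated by the integrand at `β = 1`. -/
lemma hankelIntegral_im_zero {φ : ℝ} (hφ0 : 0 < φ) (hφπ : φ < Real.pi) (hφ : Real.cos φ < 0) :
    (hankelIntegral φ 0).im = Real.pi := by
  have hlim : Tendsto (fun β => hankelIntegral φ β) (𝓝[>] 0) (𝓝 (hankelIntegral φ 0)) := by
    have hw := measurable_hankelWeight φ
    have hl := measurable_hankelLog φ
    refine tendsto_integral_filter_of_dominated_convergence
      (fun x => ‖hankelWeight φ x * Complex.exp ((1 : ℝ) * hankelLog φ x)‖)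
      (Eventually.of_forall fun β => (hw.mul (hl.const_mul _).cexp).aestronglyMeasurable) ?_
      (integrableOn_hankel hφ 1).norm (Eventually.of_forall fun x => ?_)
    · filter_upwards [mem_nhdsWithin_of_mem_nhds (Iio_mem_nhds one_pos)] with β hβ
      refine Eventually.of_forall fun x => ?_
      rw [norm_mul, norm_mul, norm_exp_mul_hankelLog, norm_exp_mul_hankelLog]
      have := hankelLog_re_nonneg φ x
      have hβ' : β ≤ 1 := le_of_lt hβ
      gcongr
    · refine Tendsto.mono_left (Continuous.tendsto ?_ 0) nhdsWithin_le_nhds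
      fun_prop
  have h1 := (Complex.continuous_im.tendsto _).comp hlim
  have h2 : Tendsto (fun β : ℝ => Real.pi * (Real.Gamma (1 - β))⁻¹) (𝓝[>] 0) (𝓝 Real.pi) := by
    have hc : ContinuousAt (fun β : ℝ => Real.pi * (Real.Gamma (1 - β))⁻¹) 0 := by
      have hΓ : ContinuousAt Real.Gamma (1 - 0) := by
        refine (Real.differentiableAt_Gamma fun m h => ?_).continuousAt
        have : (0 : ℝ) ≤ m := Nat.cast_nonneg m
        linarith
      have hs : ContinuousAt (fun β : ℝ => 1 - β) 0 := by fun_prop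
      have := ContinuousAt.comp (f := fun β : ℝ => 1 - β) hΓ hs
      exact continuousAt_const.mul (this.inv₀ (by simp))
    have := hc.tendsto.mono_left (nhdsWithin_le_nhds (s := Set.Ioi 0))
    simpa using this
  refine tendsto_nhds_unique (h1.congr' ?_) h2
  filter_upwards [self_mem_nhdsWithin] with β hβ
  exact hankelIntegral_im_of_pos hφ0 hφπ hφ hβ

/-- Hankel's formula `1 / Γ(z) = π⁻¹ Im ∫ e^σ σ^{-z} dσ` for `z > 0`. -/
lemma hankelIntegral_im_one_sub {φ : ℝ} (hφ0 : 0 < φ) (hφπ : φ < Real.pi) (hφ : Real.cos φ < 0)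
    {z : ℝ} (hz : 0 < z) :
    (hankelIntegral φ (1 - z)).im = Real.pi * (Real.Gamma z)⁻¹ := by
  -- Collapsing the contour covers `z < 1`, the limit covers `z = 1`, and the recursion lowers `z >
  -- 1` by one.
  have key : ∀ (N : ℕ) (z : ℝ), 0 < z → z ≤ N →
      (hankelIntegral φ (1 - z)).im = Real.pi * (Real.Gamma z)⁻¹ := by
    intro N
    induction N with
    | zero =>
      intro z hz hN
      exact absurd hN (by simpa using hz)
    | succ N ih =>
      intro z hz hN
      rcases lt_trichotomy z 1 with h | h | h
      · rw [hankelIntegral_im_of_pos hφ0 hφπ hφ (by linarith), sub_sub_cancel]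
      · rw [h, sub_self, hankelIntegral_im_zero hφ0 hφπ hφ, Real.Gamma_one, inv_one, mul_one]
      · have h0 : 0 < z - 1 := by linarith
        have h1 := hankelIntegral_im_rec hφ0 hφ (1 - (z - 1))
        rw [ih (z - 1) h0 (by push_cast at hN; linarith),
          show 1 - (z - 1) - 1 = 1 - z by ring, show 1 - (1 - (z - 1)) = z - 1 by ring] at h1
        have h2 := Real.Gamma_add_one h0.ne'
        rw [sub_add_cancel] at h2
        have hΓ := (Real.Gamma_pos_of_pos h0).ne'
        rw [h2]
        field_simp at h1 ⊢
        linarith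
  obtain ⟨N, hN⟩ := exists_nat_ge z
  exact key N z hz hN

/-! ### The Wright function: contour representation, decay and moments. -/

/-- The integrand of the contour representation of the Wright function. -/
noncomputable def wrightKernel (φ α θ x : ℝ) : ℂ :=
  hankelWeight φ x * Complex.exp (α * hankelLog φ x) *
    Complex.exp (-(θ * Complex.exp (α * hankelLog φ x)))

lemma measurable_wrightKernel (φ α : ℝ) :
    Measurable (fun p : ℝ × ℝ => wrightKernel φ α p.1 p.2) := by
  unfold wrightKernel
  have hw : Measurable (fun p : ℝ × ℝ => hankelWeight φ p.2) :=
    (measurable_hankelWeight φ).comp measurable_snd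
  have hl : Measurable (fun p : ℝ × ℝ => hankelLog φ p.2) :=
    (measurable_hankelLog φ).comp measurable_snd
  have he := (hl.const_mul (α : ℂ)).cexp
  exact (hw.mul he).mul
    (((Complex.measurable_ofReal.comp measurable_fst).mul he).neg.cexp)

/-- Hankel's formula at exponent `β = α(n + 1) > 0` turns the defining series into the exponential
series of `-θσ^α` under the integral. The interchange is dominated by `exp(|θ| |σ|^α)`, integrable
against the weight because `α < 1`. -/
lemma wrightFunction_eq_hankel {φ α : ℝ} (hφ0 : 0 < φ) (hφπ : φ < Real.pi)
    (hφ : Real.cos φ < 0) (hα0 : 0 < α) (hα : α < 1) (θ : ℝ) :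
    wrightFunction α θ =
      Real.pi⁻¹ * (∫ x in Set.Ioi (1 - φ), wrightKernel φ α θ x).im := by
  have hw := measurable_hankelWeight φ
  have hl := measurable_hankelLog φ
  have key := hasSum_integral_of_dominated_convergence
    (μ := volume.restrict (Set.Ioi (1 - φ)))
    (F := fun (n : ℕ) (x : ℝ) => hankelWeight φ x * Complex.exp (α * hankelLog φ x) *
      ((-(θ * Complex.exp (α * hankelLog φ x))) ^ n / n.factorial))
    (f := wrightKernel φ α θ)
    (bound := fun n x => ‖hankelWeight φ x * Complex.exp (α * hankelLog φ x)‖ *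
      ((|θ| * Real.exp (α * (hankelLog φ x).re)) ^ n / n.factorial))
    (fun n => ?_) (fun n => Eventually.of_forall fun x => ?_)
    (Eventually.of_forall fun x => (Real.summable_pow_div_factorial _).mul_left _) ?_
    (Eventually.of_forall fun x => ?_)
  · have h2 := (Complex.hasSum_im key).mul_left Real.pi⁻¹
    refine HasSum.tsum_eq ?_
    convert! h2 using 2 with n
    have h1 : (fun x => hankelWeight φ x * Complex.exp (α * hankelLog φ x) *
        ((-(θ * Complex.exp (α * hankelLog φ x))) ^ n / n.factorial)) = fun x =>
        (((-θ) ^ n / n.factorial : ℝ) : ℂ) *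
          (hankelWeight φ x * Complex.exp ((1 - (-α * n + 1 - α) : ℝ) * hankelLog φ x)) := by
      funext x
      have h3 : Complex.exp ((1 - (-α * n + 1 - α) : ℝ) * hankelLog φ x) =
          Complex.exp (α * hankelLog φ x) * Complex.exp (α * hankelLog φ x) ^ n := by
        rw [← Complex.exp_nat_mul, ← Complex.exp_add]
        congr 1
        push_cast
        ring
      rw [h3, ← neg_mul, mul_pow]
      push_cast
      ring
    have hJ : (hankelIntegral φ (1 - (-α * n + 1 - α))).im =
        Real.pi * (Real.Gamma (-α * n + 1 - α))⁻¹ := by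
      have h4 : 0 < 1 - (-α * n + 1 - α) := by
        have : 0 ≤ α * n := by positivity
        linarith
      rw [hankelIntegral_im_of_pos hφ0 hφπ hφ h4, sub_sub_cancel]
    rw [h1, integral_const_mul, Complex.im_ofReal_mul]
    rw [hankelIntegral] at hJ
    rw [hJ, mul_inv]
    field_simp
  · exact ((hw.mul (hl.const_mul _).cexp).mul
      ((((hl.const_mul _).cexp.const_mul _).neg.pow_const n).div_const _)).aestronglyMeasurable
  · rw [norm_mul, norm_div, norm_pow, norm_neg, norm_mul (θ : ℂ), norm_exp_mul_hankelLog]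
    simp
  · refine (integrableOn_hankel_exp hφ hα0 hα α |θ|).congr (Eventually.of_forall fun x => ?_)
    have := (NormedSpace.expSeries_div_hasSum_exp (𝔸 := ℝ)
      (|θ| * Real.exp (α * (hankelLog φ x).re))).tsum_eq
    rw [← Real.exp_eq_exp_ℝ] at this
    simp only [tsum_mul_left, this]
  · have := NormedSpace.expSeries_div_hasSum_exp (𝔸 := ℂ)
      (-(θ * Complex.exp (α * hankelLog φ x)))
    rw [← Complex.exp_eq_exp_ℂ] at this
    exact this.mul_left _

/-- On the contour `|σ| ≥ 1` and `0 ≤ arg σ ≤ φ`, so `Re σ^α = |σ|^α cos(α arg σ)` is bounded below.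
This is the source of the decay in `θ`. -/
lemma cos_le_re_exp_hankelLog {φ α x : ℝ} (hα0 : 0 < α) (hαφ : α * φ < Real.pi / 2)
    (hφ0 : 0 < φ) (hx : 1 - φ < x) :
    Real.cos (α * φ) ≤ (Complex.exp (α * hankelLog φ x)).re := by
  have him : 0 ≤ (hankelLog φ x).im ∧ (hankelLog φ x).im ≤ φ := by
    rw [hankelLog_im]
    split_ifs with h
    · constructor <;> linarith
    · exact ⟨hφ0.le, le_rfl⟩
  rw [Complex.exp_re, Complex.re_ofReal_mul, Complex.im_ofReal_mul]
  have h1 : Real.cos (α * φ) ≤ Real.cos (α * (hankelLog φ x).im) := by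
    refine Real.cos_le_cos_of_nonneg_of_le_pi (by have := him.1; positivity)
      (by linarith [Real.pi_pos]) ?_
    have := him.2
    gcongr
  have h0 : 0 ≤ Real.cos (α * φ) :=
    Real.cos_nonneg_of_mem_Icc ⟨by have := Real.pi_pos; have : 0 < α * φ := by positivity
                                   linarith, hαφ.le⟩
  have h2 : 1 ≤ Real.exp (α * (hankelLog φ x).re) := by
    have := hankelLog_re_nonneg φ x
    exact Real.one_le_exp (by positivity)
  nlinarith

lemma norm_wrightKernel_le {φ α x θ : ℝ} (hα0 : 0 < α) (hαφ : α * φ < Real.pi / 2)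
    (hφ0 : 0 < φ) (hx : 1 - φ < x) (hθ : 0 ≤ θ) :
    ‖wrightKernel φ α θ x‖ ≤ Real.exp (-Real.cos (α * φ) * θ) *
      ‖hankelWeight φ x * Complex.exp (α * hankelLog φ x)‖ := by
  rw [wrightKernel, norm_mul, mul_comm, Complex.norm_exp, Complex.neg_re, Complex.re_ofReal_mul]
  have := cos_le_re_exp_hankelLog hα0 hαφ hφ0 hx
  gcongr
  nlinarith

/-- Joint integrability, needed for Fubini in the moment computation. -/
lemma integrable_pow_mul_wrightKernel {φ α : ℝ} (hφ0 : 0 < φ) (hφ : Real.cos φ < 0) (hα0 : 0 < α)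
    (hαφ : α * φ < Real.pi / 2) (k : ℕ) :
    Integrable (fun p : ℝ × ℝ => ((p.1 ^ k : ℝ) : ℂ) * wrightKernel φ α p.1 p.2)
      ((volume.restrict (Set.Ioi 0)).prod (volume.restrict (Set.Ioi (1 - φ)))) := by
  have hc : 0 < Real.cos (α * φ) :=
    Real.cos_pos_of_mem_Ioo ⟨by have := Real.pi_pos; have : 0 < α * φ := by positivity
                                linarith, hαφ⟩
  have h1 : IntegrableOn (fun θ : ℝ => θ ^ k * Real.exp (-Real.cos (α * φ) * θ)) (Set.Ioi 0) := by
    refine (integrableOn_rpow_mul_exp_mul (β := k + 1) (by positivity)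
      (by linarith : -Real.cos (α * φ) < 0)).congr_fun (fun t ht => ?_) measurableSet_Ioi
    simp
  refine (h1.mul_prod (integrableOn_hankel hφ α).norm).mono' ?_ ?_
  · exact ((Complex.measurable_ofReal.comp (measurable_fst.pow_const k)).mul
      (measurable_wrightKernel φ α)).aestronglyMeasurable
  · rw [Measure.prod_restrict]
    refine (ae_restrict_iff' (measurableSet_Ioi.prod measurableSet_Ioi)).mpr
      (Eventually.of_forall fun p hp => ?_)
    have hp1 : 0 < p.1 := hp.1
    rw [norm_mul, Complex.norm_real, Real.norm_of_nonneg (by positivity), mul_assoc]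
    gcongr
    exact norm_wrightKernel_le hα0 hαφ hφ0 hp.2 hp1.le

/-- A Gamma integral at `σ^α`: the factor `σ^α` times `k! σ^(-α(k+1))` leaves `k! σ^(-αk)`. The
exponent is now `≤ 0`, which is why Hankel's formula is needed beyond the collapsing range. -/
lemma integral_pow_mul_wrightKernel {φ α x : ℝ} (hφ0 : 0 < φ) (hα0 : 0 < α)
    (hαφ : α * φ < Real.pi / 2) (hx : 1 - φ < x) (k : ℕ) :
    ∫ θ in Set.Ioi (0 : ℝ), ((θ ^ k : ℝ) : ℂ) * wrightKernel φ α θ x =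
      (k.factorial : ℝ) *
        (hankelWeight φ x * Complex.exp ((1 - (1 + α * k) : ℝ) * hankelLog φ x)) := by
  have hc : 0 < Real.cos (α * φ) :=
    Real.cos_pos_of_mem_Ioo ⟨by have := Real.pi_pos; have : 0 < α * φ := by positivity
                                linarith, hαφ⟩
  have hω := hc.trans_le (cos_le_re_exp_hankelLog hα0 hαφ hφ0 hx)
  have h1 := integral_rpow_mul_cexp_neg_mul (β := k + 1) (by positivity) hω
  have h2 : ∀ θ : ℝ, ((θ ^ k : ℝ) : ℂ) * wrightKernel φ α θ x =
      (hankelWeight φ x * Complex.exp (α * hankelLog φ x)) *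
        (((θ ^ ((k : ℝ) + 1 - 1) : ℝ) : ℂ) *
          Complex.exp (-(Complex.exp (α * hankelLog φ x) * θ))) := fun θ => by
    rw [wrightKernel, add_sub_cancel_right, Real.rpow_natCast,
      mul_comm (Complex.exp (α * hankelLog φ x)) (θ : ℂ)]
    ring
  simp_rw [h2]
  rw [integral_const_mul, h1]
  have h3 : ((((k : ℝ) + 1 : ℝ)) : ℂ) = ((k + 1 : ℕ) : ℂ) := by push_cast; ring
  rw [h3, Complex.cpow_natCast, Nat.cast_add_one, Complex.Gamma_nat_eq_factorial, one_div,
    ← Complex.exp_neg, ← Complex.exp_nat_mul]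
  have h4 : Complex.exp ((1 - (1 + α * k) : ℝ) * hankelLog φ x) =
      Complex.exp (α * hankelLog φ x) *
        Complex.exp ((k + 1 : ℕ) * -(α * hankelLog φ x)) := by
    rw [← Complex.exp_add]
    congr 1
    push_cast
    ring
  rw [h4]
  push_cast
  ring

/-- An admissible opening of the Hankel contour for the Wright function. -/
lemma exists_hankel_angle {α : ℝ} (hα0 : 0 < α) (hα : α < 1) :
    ∃ φ : ℝ, 0 < φ ∧ φ < Real.pi ∧ Real.cos φ < 0 ∧ α * φ < Real.pi / 2 := by
  have hπ := Real.pi_pos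
  have h1 : Real.pi / (1 + α) < Real.pi := by
    rw [div_lt_iff₀ (by linarith)]; nlinarith
  -- The angle must exceed `π/2` for convergence and stay below both `π` and `π/(2α)`; `π/(1 + α)`
  -- does so for `0 < α < 1`.
  refine ⟨Real.pi / (1 + α), by positivity, h1, ?_, ?_⟩
  · refine Real.cos_neg_of_pi_div_two_lt_of_lt ?_ (by linarith)
    rw [lt_div_iff₀ (by linarith)]; nlinarith
  · rw [mul_div_assoc', div_lt_iff₀ (by linarith)]; nlinarith

/-- Exponential decay of the Wright function on the positive half line. -/
lemma exists_wrightFunction_le {α : ℝ} (hα0 : 0 < α) (hα : α < 1) :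
    ∃ c C : ℝ, 0 < c ∧ ∀ θ : ℝ, 0 ≤ θ → |wrightFunction α θ| ≤ C * Real.exp (-c * θ) := by
  obtain ⟨φ, hφ0, hφπ, hφ, hαφ⟩ := exists_hankel_angle hα0 hα
  have hc : 0 < Real.cos (α * φ) :=
    Real.cos_pos_of_mem_Ioo ⟨by have := Real.pi_pos; have : 0 < α * φ := by positivity
                                linarith, hαφ⟩
  refine ⟨Real.cos (α * φ), Real.pi⁻¹ *
    ∫ x in Set.Ioi (1 - φ), ‖hankelWeight φ x * Complex.exp (α * hankelLog φ x)‖, hc,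
    fun θ hθ => ?_⟩
  rw [wrightFunction_eq_hankel hφ0 hφπ hφ hα0 hα, abs_mul,
    abs_of_pos (inv_pos.mpr Real.pi_pos), mul_assoc]
  refine mul_le_mul_of_nonneg_left ?_ (inv_pos.mpr Real.pi_pos).le
  refine (Complex.abs_im_le_norm _).trans ?_
  rw [mul_comm, ← integral_const_mul]
  refine norm_integral_le_of_norm_le ((integrableOn_hankel hφ α).norm.const_mul _) ?_
  exact (ae_restrict_iff' measurableSet_Ioi).mpr (Eventually.of_forall fun x hx =>
    norm_wrightKernel_le hα0 hαφ hφ0 hx hθ)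

lemma pow_mul_wrightFunction_eq {φ α : ℝ} (hφ0 : 0 < φ) (hφπ : φ < Real.pi)
    (hφ : Real.cos φ < 0) (hα0 : 0 < α) (hα : α < 1) (k : ℕ) (θ : ℝ) :
    θ ^ k * wrightFunction α θ = Real.pi⁻¹ *
      (∫ x in Set.Ioi (1 - φ), ((θ ^ k : ℝ) : ℂ) * wrightKernel φ α θ x).im := by
  rw [wrightFunction_eq_hankel hφ0 hφπ hφ hα0 hα, integral_const_mul, Complex.im_ofReal_mul]
  ring

lemma integrableOn_pow_mul_wrightFunction {α : ℝ} (hα0 : 0 < α) (hα : α < 1) (k : ℕ) :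
    IntegrableOn (fun θ => θ ^ k * wrightFunction α θ) (Set.Ioi 0) := by
  obtain ⟨φ, hφ0, hφπ, hφ, hαφ⟩ := exists_hankel_angle hα0 hα
  simp_rw [pow_mul_wrightFunction_eq hφ0 hφπ hφ hα0 hα]
  exact ((integrable_pow_mul_wrightKernel hφ0 hφ hα0 hαφ k).integral_prod_left.im).const_mul _

/-- The moments of the Wright function. -/
lemma integral_pow_mul_wrightFunction {α : ℝ} (hα0 : 0 < α) (hα : α < 1) (k : ℕ) :
    ∫ θ in Set.Ioi (0 : ℝ), θ ^ k * wrightFunction α θ =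
      k.factorial * (Real.Gamma (1 + α * k))⁻¹ := by
  obtain ⟨φ, hφ0, hφπ, hφ, hαφ⟩ := exists_hankel_angle hα0 hα
  have hint := integrable_pow_mul_wrightKernel hφ0 hφ hα0 hαφ k
  simp_rw [pow_mul_wrightFunction_eq hφ0 hφπ hφ hα0 hα]
  have him : ∫ θ in Set.Ioi (0 : ℝ),
      (∫ x in Set.Ioi (1 - φ), ((θ ^ k : ℝ) : ℂ) * wrightKernel φ α θ x).im =
      (∫ θ in Set.Ioi (0 : ℝ),
        ∫ x in Set.Ioi (1 - φ), ((θ ^ k : ℝ) : ℂ) * wrightKernel φ α θ x).im :=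
    integral_im hint.integral_prod_left
  rw [integral_const_mul, him, integral_integral_swap hint,
    setIntegral_congr_fun measurableSet_Ioi
      (fun x hx => integral_pow_mul_wrightKernel hφ0 hα0 hαφ hx k),
    integral_const_mul, Complex.im_ofReal_mul]
  have hJ := hankelIntegral_im_one_sub hφ0 hφπ hφ (z := 1 + α * k) (by positivity)
  rw [hankelIntegral] at hJ
  rw [hJ]
  field_simp [Real.pi_ne_zero]

/-! ### Semigroups with bounded generator. -/

namespace C0Semigroup

variable {H : Type*} [NormedAddCommGroup H] [InnerProductSpace ℝ H]

lemma continuousWithinAt_zero (S : C0Semigroup H) (x : H) :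
    ContinuousWithinAt (fun t => S.op t x) (Set.Ici 0) 0 := by
  rw [← continuousWithinAt_Ioi_iff_Ici]
  have h := S.tendsto_zero x
  rw [ContinuousWithinAt]
  simpa [S.op_zero] using h

/-- Otherwise norms blow up along times tending to `0`, where orbits converge, against
Banach–Steinhaus. -/
lemma exists_norm_op_le [CompleteSpace H] (S : C0Semigroup H) :
    ∃ δ M : ℝ, 0 < δ ∧ ∀ t, 0 ≤ t → t ≤ δ → ‖S.op t‖ ≤ M := by
  by_contra! hcon
  choose h h0 hδ hM using fun n : ℕ => hcon (1 / ((n : ℝ) + 1)) n (by positivity)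
  have hlim : Tendsto h atTop (𝓝[≥] 0) := by
    refine tendsto_nhdsWithin_iff.mpr ⟨?_, Eventually.of_forall h0⟩
    exact squeeze_zero h0 hδ tendsto_one_div_add_atTop_nhds_zero_nat
  obtain ⟨C, hC⟩ := banach_steinhaus (g := fun n => S.op (h n)) fun x => by
    have hx : Tendsto (fun n => ‖S.op (h n) x‖) atTop (𝓝 ‖S.op 0 x‖) :=
      ((S.continuousWithinAt_zero x).tendsto.comp hlim).norm
    obtain ⟨C, hC⟩ := hx.bddAbove_range
    exact ⟨C, fun n => hC ⟨n, rfl⟩⟩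
  obtain ⟨n, hn⟩ := exists_nat_gt C
  linarith [hM n, hC n]

lemma continuousOn_op_apply (S : C0Semigroup H) {δ M : ℝ}
    (hM : ∀ t, 0 ≤ t → t ≤ δ → ‖S.op t‖ ≤ M) (x : H) :
    ContinuousOn (fun t => S.op t x) (Set.Icc 0 δ) := by
  intro t ht
  have hlim : Tendsto (fun s => |s - t|) (𝓝[Set.Icc 0 δ] t) (𝓝[≥] 0) := by
    refine tendsto_nhdsWithin_iff.mpr ⟨?_, Eventually.of_forall fun s => abs_nonneg (s - t)⟩
    exact ((by fun_prop : Continuous fun s : ℝ => |s - t|).tendsto' t 0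
      (by simp)).mono_left nhdsWithin_le_nhds
  have h1 : Tendsto (fun s => M * ‖S.op |s - t| x - x‖) (𝓝[Set.Icc 0 δ] t) (𝓝 0) := by
    have h2 := (S.continuousWithinAt_zero x).tendsto.comp hlim
    have h3 := ((h2.sub_const x).norm).const_mul M
    simpa [S.op_zero] using h3
  have hdiff : ∀ a b : ℝ, 0 ≤ a → a ≤ δ → a ≤ b →
      ‖S.op b x - S.op a x‖ ≤ M * ‖S.op (b - a) x - x‖ := fun a b ha haδ hab => by
    have h4 : S.op b x = S.op a (S.op (b - a) x) := by
      have := S.op_add a (b - a) ha (by linarith)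
      rw [add_sub_cancel] at this
      rw [this]; rfl
    rw [h4, ← map_sub]
    exact ((S.op a).le_opNorm _).trans (by gcongr; exact hM a ha haδ)
  refine tendsto_iff_norm_sub_tendsto_zero.mpr ?_
  refine squeeze_zero' (Eventually.of_forall fun s => norm_nonneg _) ?_ h1
  filter_upwards [self_mem_nhdsWithin] with s hs
  rcases le_total t s with h | h
  · rw [abs_of_nonneg (by linarith)]
    exact hdiff t s ht.1 ht.2 h
  · rw [abs_of_nonpos (by linarith), neg_sub, norm_sub_rev]
    exact hdiff s t hs.1 hs.2 h

lemma hasDerivWithinAt_op_apply (S : C0Semigroup H) {A : H →L[ℝ] H}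
    (hA : ∀ x, Tendsto (fun h : ℝ => h⁻¹ • (S.op h x - x)) (𝓝[>] 0) (𝓝 (A x)))
    (x : H) {t : ℝ} (ht : 0 ≤ t) :
    HasDerivWithinAt (fun t => S.op t x) (A (S.op t x)) (Set.Ici t) t := by
  rw [← hasDerivWithinAt_Ioi_iff_Ici, hasDerivWithinAt_iff_tendsto_slope' (by simp)]
  have hlim : Tendsto (fun s => s - t) (𝓝[>] t) (𝓝[>] 0) := by
    refine tendsto_nhdsWithin_iff.mpr ⟨?_, ?_⟩
    · exact ((by fun_prop : Continuous fun s : ℝ => s - t).tendsto' t 0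
        (by simp)).mono_left nhdsWithin_le_nhds
    · filter_upwards [self_mem_nhdsWithin] with s hs
      exact sub_pos.mpr (Set.mem_Ioi.mp hs)
  refine ((hA (S.op t x)).comp hlim).congr' ?_
  filter_upwards [self_mem_nhdsWithin] with s hs
  have hs' : t < s := hs
  have := S.op_add (s - t) t (by linarith) ht
  rw [sub_add_cancel] at this
  simp [slope, this]

lemma op_nsmul (S : C0Semigroup H) {t : ℝ} (ht : 0 ≤ t) (n : ℕ) :
    S.op (n * t) = S.op t ^ n := by
  induction n with
  | zero => simp [S.op_zero]; rfl
  | succ n ih =>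
    rw [Nat.cast_add_one, add_mul, one_mul, S.op_add _ _ (by positivity) ht, ih, pow_succ]
    rfl

/-- A `C₀`-semigroup with bounded everywhere defined generator is the exponential semigroup. -/
lemma op_eq_exp [CompleteSpace H] (S : C0Semigroup H) {A : H →L[ℝ] H}
    (hA : ∀ x, Tendsto (fun h : ℝ => h⁻¹ • (S.op h x - x)) (𝓝[>] 0) (𝓝 (A x)))
    {t : ℝ} (ht : 0 ≤ t) : S.op t = NormedSpace.exp (t • A) := by
  let +nondep : NormedAlgebra ℚ (H →L[ℝ] H) := .restrictScalars ℚ ℝ (H →L[ℝ] H)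
  obtain ⟨δ, M, hδ, hM⟩ := S.exists_norm_op_le
  -- On `[0, δ]` the function `exp(-sA) S(s) x` is continuous with zero right derivative, hence
  -- constant.
  have hsmall : ∀ t, 0 ≤ t → t ≤ δ → S.op t = NormedSpace.exp (t • A) := by
    intro t ht htδ
    ext x
    have hE : ∀ s : ℝ, HasDerivAt (fun u : ℝ => NormedSpace.exp (u • -A))
        (NormedSpace.exp (s • -A) * -A) s := fun s => hasDerivAt_exp_smul_const (-A) s
    have hconst := constant_of_has_deriv_right_zero (a := 0) (b := δ)
      (f := fun s => NormedSpace.exp (s • -A) (S.op s x))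
      (ContinuousOn.clm_apply (fun s _ => (hE s).continuousAt.continuousWithinAt)
        (S.continuousOn_op_apply hM x))
      (fun s hs => by
        convert! (hE s).hasDerivWithinAt.clm_apply (S.hasDerivWithinAt_op_apply hA x hs.1) using 1
        simp) t ⟨ht, htδ⟩
    have h1 : NormedSpace.exp (t • A) * NormedSpace.exp (t • -A) = 1 := by
      rw [← NormedSpace.exp_add_of_commute]
      · simp
      · rw [smul_neg]; exact (Commute.refl _).neg_right
    have h2 := congrArg (fun y => NormedSpace.exp (t • A) y) hconst
    simp only [zero_smul, NormedSpace.exp_zero, S.op_zero] at h2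
    rw [← mul_apply_eq_comp, h1] at h2
    simpa using h2
  -- Larger times follow from `S(t) = S(t/(n+1))^(n+1)`; using `n + 1` avoids division by zero.
  obtain ⟨n, hn⟩ := exists_nat_ge (t / δ)
  have hn' : t / (n + 1 : ℕ) ≤ δ := by
    rw [div_le_iff₀ hδ] at hn
    rw [div_le_iff₀ (by positivity)]
    push_cast
    nlinarith
  have h3 := S.op_nsmul (t := t / (n + 1 : ℕ)) (by positivity) (n + 1)
  rw [hsmall _ (by positivity) hn', ← NormedSpace.exp_nsmul,
    mul_div_cancel₀ _ (by positivity)] at h3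
  rw [h3, ← Nat.cast_smul_eq_nsmul ℝ, smul_smul, mul_div_cancel₀ _ (by positivity)]

lemma IsGenerator.tendsto {S : C0Semigroup H} {A : H →L[ℝ] H}
    (hA : S.IsGenerator ((A : H →ₗ[ℝ] H).toPMap ⊤)) (x : H) :
    Tendsto (fun h : ℝ => h⁻¹ • (S.op h x - x)) (𝓝[>] 0) (𝓝 (A x)) := by
  refine (hA x (A x)).mp ?_
  rw [LinearPMap.mem_graph_iff]
  exact ⟨⟨x, trivial⟩, rfl, rfl⟩

end C0Semigroup

/-! ### Vector-valued power series of a real variable. -/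

section PowerSeries

variable {E : Type*} [NormedAddCommGroup E] [InnerProductSpace ℝ E]

/-- The formal power series `∑ xᵐ • a m` of a real variable. -/
noncomputable def realPowerSeries (a : ℕ → E) : FormalMultilinearSeries ℝ ℝ E :=
  fun m => ContinuousMultilinearMap.mkPiRing ℝ (Fin m) (a m)

lemma hasFPowerSeriesOnBall_realPowerSeries [CompleteSpace E] {a : ℕ → E} {ρ : ℝ} (hρ : 0 < ρ)
    (ha : Summable fun m => ρ ^ m • a m) :
    HasFPowerSeriesOnBall (realPowerSeries a).sum (realPowerSeries a) 0 (ENNReal.ofReal ρ) := by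
  have hr : ENNReal.ofReal ρ ≤ (realPowerSeries a).radius := by
    rw [ENNReal.ofReal]
    refine (realPowerSeries a).le_radius_of_tendsto (l := 0) ?_
    have h := ha.tendsto_atTop_zero.norm
    rw [norm_zero] at h
    refine h.congr fun m => ?_
    rw [norm_smul, norm_pow, Real.norm_of_nonneg hρ.le, realPowerSeries,
      ContinuousMultilinearMap.norm_mkPiRing, Real.coe_toNNReal _ hρ.le, mul_comm]
  have h0 : 0 < ENNReal.ofReal ρ := ENNReal.ofReal_pos.mpr hρ
  exact ((realPowerSeries a).hasFPowerSeriesOnBall (h0.trans_le hr)).mono h0 hr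

lemma realPowerSeries_sum_eq {a : ℕ → E} {x : ℝ} {y : E} (h : HasSum (fun m => x ^ m • a m) y) :
    (realPowerSeries a).sum x = y := by
  rw [FormalMultilinearSeries.sum, ← h.tsum_eq]
  simp [realPowerSeries]

/-- Convergence at `ρ` bounds the radius below by `ρ`, so continuity is obtained only short of the
endpoint. -/
lemma continuousOn_of_hasSum_pow_smul [CompleteSpace E] {a : ℕ → E} {ρ : ℝ} (hρ : 0 < ρ) {G : ℝ → E}
    (hG : ∀ x ∈ Set.Icc 0 ρ, HasSum (fun m => x ^ m • a m) (G x)) :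
    ContinuousOn G (Set.Ico 0 ρ) := by
  have hp := hasFPowerSeriesOnBall_realPowerSeries hρ (hG ρ ⟨hρ.le, le_rfl⟩).summable
  refine (hp.continuousOn.mono fun x hx => ?_).congr fun x hx =>
    (realPowerSeries_sum_eq (hG x ⟨hx.1, hx.2.le⟩)).symm
  rw [Metric.eball_ofReal, Metric.mem_ball, dist_zero_right, Real.norm_of_nonneg hx.1]
  exact hx.2

/-- Identity theorem for power series, tested against a vector. -/
lemma inner_coeff_eq_zero_of_hasSum [CompleteSpace E] {a : ℕ → E} {ρ : ℝ} (hρ : 0 < ρ) {G : ℝ → E}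
    (hG : ∀ x ∈ Set.Icc 0 ρ, HasSum (fun m => x ^ m • a m) (G x)) {z : E}
    (hz : ∃ᶠ x in 𝓝[>] 0, inner ℝ z (G x) = 0) (m : ℕ) : inner ℝ z (a m) = 0 := by
  have hp := hasFPowerSeriesOnBall_realPowerSeries hρ (hG ρ ⟨hρ.le, le_rfl⟩).summable
  have hq := ((innerSL ℝ z).comp_hasFPowerSeriesOnBall hp).hasFPowerSeriesAt
  have hfreq : ∃ᶠ x in 𝓝[≠] 0, ((innerSL ℝ z) ∘ (realPowerSeries a).sum) x = 0 := by
    refine Frequently.filter_mono ?_ (nhdsWithin_mono 0 (s := Set.Ioi 0) fun x hx => ne_of_gt hx)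
    have hev : ∀ᶠ x in 𝓝[>] (0 : ℝ), x ∈ Set.Ioc 0 ρ := Ioc_mem_nhdsGT hρ
    refine (hz.and_eventually hev).mono fun x hx => ?_
    rw [Function.comp_apply, realPowerSeries_sum_eq (hG x ⟨hx.2.1.le, hx.2.2⟩)]
    exact hx.1
  have hzero := hq.analyticAt.frequently_zero_iff_eventually_zero.mp hfreq
  have h0 := (hq.congr hzero).eq_zero
  have h1 := congrArg (fun q : FormalMultilinearSeries ℝ ℝ ℝ => q m fun _ => 1) h0
  simpa [realPowerSeries] using h1

end PowerSeries

/-! ### Power series expansion of `𝒫_α`. -/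

namespace C0Semigroup

variable {H : Type*} [NormedAddCommGroup H] [InnerProductSpace ℝ H]

lemma norm_pow_apply_le (A : H →L[ℝ] H) (m : ℕ) (y : H) : ‖(A ^ m) y‖ ≤ ‖A‖ ^ m * ‖y‖ := by
  induction m with
  | zero => simp
  | succ m ih =>
    rw [pow_succ', mul_apply_eq_comp, pow_succ', mul_assoc]
    exact (A.le_opNorm _).trans (by gcongr)

variable [CompleteSpace H]

lemma hasSum_exp_smul_apply (A : H →L[ℝ] H) (s : ℝ) (y : H) :
    HasSum (fun m : ℕ => (s ^ m * ((m.factorial : ℝ))⁻¹) • (A ^ m) y)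
      (NormedSpace.exp (s • A) y) := by
  let +nondep : NormedAlgebra ℚ (H →L[ℝ] H) := .restrictScalars ℚ ℝ (H →L[ℝ] H)
  have h := (NormedSpace.exp_series_hasSum_exp' (𝕂 := ℝ) (s • A)).mapL
    (ContinuousLinearMap.apply ℝ H y)
  convert! h using 2 with m
  simp [smul_pow, smul_smul, mul_comm]

/-- The `m`-th term of the exponential meets the moment of order `m + 1`, and `(m + 1)! / m!` leaves
the factor `m + 1`. For `x‖A‖ ≤ c/2` the decay `e^(-cθ)` beats the exponential, leaving the majorant
`θ e^(-cθ/2)` up to a constant. -/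
lemma hasSum_integral_wright_smul_exp {α : ℝ} (hα0 : 0 < α) (hα : α < 1) (A : H →L[ℝ] H)
    {c C : ℝ} (hc : 0 < c) (hC : ∀ θ : ℝ, 0 ≤ θ → |wrightFunction α θ| ≤ C * Real.exp (-c * θ))
    {x : ℝ} (hx0 : 0 ≤ x) (hx : x * ‖A‖ ≤ c / 2) (y : H) :
    HasSum (fun m : ℕ => x ^ m •
        ((α * (m + 1) * (Real.Gamma (1 + α * (m + 1)))⁻¹) • (A ^ m) y))
      (∫ θ in Set.Ioi (0 : ℝ), (α * θ * wrightFunction α θ) • NormedSpace.exp ((x * θ) • A) y) := by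
  have hmeas : AEStronglyMeasurable (wrightFunction α) (volume.restrict (Set.Ioi 0)) := by
    simpa using (integrableOn_pow_mul_wrightFunction hα0 hα 0).aestronglyMeasurable
  have hexp : ∀ θ : ℝ, HasSum
      (fun m : ℕ => α * θ * |wrightFunction α θ| * ((x * θ * ‖A‖) ^ m / m.factorial) * ‖y‖)
      (α * θ * |wrightFunction α θ| * Real.exp (x * θ * ‖A‖) * ‖y‖) := fun θ => by
    have := NormedSpace.expSeries_div_hasSum_exp (𝔸 := ℝ) (x * θ * ‖A‖)
    rw [← Real.exp_eq_exp_ℝ] at this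
    exact (this.mul_left _).mul_right _
  have key := hasSum_integral_of_dominated_convergence (μ := volume.restrict (Set.Ioi (0 : ℝ)))
    (F := fun (m : ℕ) θ => (α * θ * wrightFunction α θ) •
      (((x * θ) ^ m * ((m.factorial : ℝ))⁻¹) • (A ^ m) y))
    (f := fun θ => (α * θ * wrightFunction α θ) • NormedSpace.exp ((x * θ) • A) y)
    (bound := fun m θ => α * θ * |wrightFunction α θ| * ((x * θ * ‖A‖) ^ m / m.factorial) * ‖y‖)
    (fun m => ?_)
    (fun m => (ae_restrict_iff' measurableSet_Ioi).mpr (Eventually.of_forall fun θ hθ => ?_))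
    (Eventually.of_forall fun θ => (hexp θ).summable) ?_
    (Eventually.of_forall fun θ => (hasSum_exp_smul_apply A _ y).const_smul _)
  · convert! key using 2 with m
    have h1 : ∀ θ : ℝ, (α * θ * wrightFunction α θ) •
        (((x * θ) ^ m * ((m.factorial : ℝ))⁻¹) • (A ^ m) y) =
        (α * x ^ m * ((m.factorial : ℝ))⁻¹ * (θ ^ (m + 1) * wrightFunction α θ)) • (A ^ m) y :=
      fun θ => by
        rw [smul_smul]
        congr 1
        ring
    simp_rw [h1]
    rw [integral_smul_const, integral_const_mul, integral_pow_mul_wrightFunction hα0 hα,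
      smul_smul]
    congr 1
    have hm : (m.factorial : ℝ) ≠ 0 := by positivity
    rw [Nat.factorial_succ]
    push_cast
    field_simp
  · exact (((measurable_id.const_mul α).aestronglyMeasurable).mul hmeas).smul
      (by fun_prop : Continuous fun θ : ℝ =>
        ((x * θ) ^ m * ((m.factorial : ℝ))⁻¹) • (A ^ m) y).aestronglyMeasurable
  · have hθ' : (0 : ℝ) < θ := hθ
    rw [norm_smul, norm_smul, norm_mul, norm_mul, norm_mul, Real.norm_eq_abs (wrightFunction α θ),
      Real.norm_of_nonneg hα0.le, Real.norm_of_nonneg hθ'.le, norm_inv, norm_pow,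
      Real.norm_of_nonneg (by positivity : 0 ≤ x * θ), RCLike.norm_natCast, mul_pow _ ‖A‖]
    have h2 : ‖(A ^ m) y‖ ≤ ‖A‖ ^ m * ‖y‖ := norm_pow_apply_le A m y
    calc α * θ * |wrightFunction α θ| * ((x * θ) ^ m * (m.factorial : ℝ)⁻¹ * ‖(A ^ m) y‖)
        ≤ α * θ * |wrightFunction α θ| *
          ((x * θ) ^ m * (m.factorial : ℝ)⁻¹ * (‖A‖ ^ m * ‖y‖)) := by gcongr
      _ = _ := by ring
  · simp_rw [fun θ => (hexp θ).tsum_eq]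
    have hint : IntegrableOn (fun θ : ℝ => α * C * ‖y‖ *
        (θ ^ ((2 : ℝ) - 1) * Real.exp (-(c / 2) * θ))) (Set.Ioi 0) :=
      (integrableOn_rpow_mul_exp_mul two_pos (by linarith)).const_mul _
    refine hint.mono' ?_ ?_
    · exact ((((measurable_id.const_mul α).aestronglyMeasurable).mul hmeas.norm).mul
        (by fun_prop : Measurable fun θ : ℝ =>
          Real.exp (x * θ * ‖A‖)).aestronglyMeasurable).mul_const _
    · refine (ae_restrict_iff' measurableSet_Ioi).mpr (Eventually.of_forall fun θ hθ => ?_)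
      have hθ' : (0 : ℝ) < θ := hθ
      rw [Real.norm_of_nonneg (by positivity), show (2 : ℝ) - 1 = 1 by norm_num, Real.rpow_one]
      have h3 : x * θ * ‖A‖ ≤ c / 2 * θ := by
        calc x * θ * ‖A‖ = x * ‖A‖ * θ := by ring
          _ ≤ _ := by gcongr
      have h4 : Real.exp (-c * θ) * Real.exp (c / 2 * θ) = Real.exp (-(c / 2) * θ) := by
        rw [← Real.exp_add]; congr 1; ring
      calc α * θ * |wrightFunction α θ| * Real.exp (x * θ * ‖A‖) * ‖y‖
          ≤ α * θ * (C * Real.exp (-c * θ)) * Real.exp (c / 2 * θ) * ‖y‖ := by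
            gcongr
            · exact mul_nonneg (by positivity) ((abs_nonneg _).trans (hC θ hθ'.le))
            · exact hC θ hθ'.le
        _ = α * θ * C * (Real.exp (-c * θ) * Real.exp (c / 2 * θ)) * ‖y‖ := by ring
        _ = _ := by rw [h4]; ring

/-- For small times `𝒫_α(t)` is a power series in `t ^ α` with coefficients nonzero multiples of
the powers of the bounded generator. -/
lemma exists_hasSum_solP (S : C0Semigroup H) {A : H →L[ℝ] H}
    (hA : S.IsGenerator ((A : H →ₗ[ℝ] H).toPMap ⊤)) {α : ℝ} (hα0 : 0 < α) (hα : α ≤ 1) :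
    ∃ (κ : ℕ → ℝ) (ρ : ℝ), 0 < ρ ∧ (∀ m, κ m ≠ 0) ∧ ∀ t, 0 ≤ t → t ^ α ≤ ρ → ∀ y,
      HasSum (fun m : ℕ => (t ^ α) ^ m • (κ m • (A ^ m) y)) (S.solP α t y) := by
  have hS : ∀ {t : ℝ}, 0 ≤ t → S.op t = NormedSpace.exp (t • A) := S.op_eq_exp hA.tendsto
  rcases eq_or_lt_of_le hα with rfl | hα1
  · refine ⟨fun m => ((m.factorial : ℝ))⁻¹, 1, one_pos, fun m => by positivity,
      fun t ht _ y => ?_⟩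
    rw [solP, if_pos rfl, hS ht]
    simpa [smul_smul] using hasSum_exp_smul_apply A t y
  · obtain ⟨c, C, hc, hC⟩ := exists_wrightFunction_le hα0 hα1
    -- The radius gives `t^α ‖A‖ ≤ c/2`; the `+ 1` covers `A = 0`.
    refine ⟨fun m => α * (m + 1) * (Real.Gamma (1 + α * (m + 1)))⁻¹, c / 2 / (‖A‖ + 1),
      by positivity, fun m => ?_, fun t ht htρ y => ?_⟩
    · have : 0 < Real.Gamma (1 + α * (m + 1)) := Real.Gamma_pos_of_pos (by positivity)
      positivity
    · have hx0 : 0 ≤ t ^ α := Real.rpow_nonneg ht _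
      have hx : t ^ α * ‖A‖ ≤ c / 2 := by
        rw [le_div_iff₀ (by positivity)] at htρ
        nlinarith
      rw [solP, if_neg hα1.ne]
      have hcongr : ∫ θ in Set.Ioi (0 : ℝ), (α * θ * wrightFunction α θ) • S.op (t ^ α * θ) y =
          ∫ θ in Set.Ioi (0 : ℝ), (α * θ * wrightFunction α θ) •
            NormedSpace.exp ((t ^ α * θ) • A) y := by
        refine setIntegral_congr_fun measurableSet_Ioi fun θ hθ => ?_
        have hθ' : (0 : ℝ) < θ := hθ
        simp only [hS (mul_nonneg hx0 hθ'.le)]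
      rw [hcongr]
      exact hasSum_integral_wright_smul_exp hα0 hα1 A hc hC hx0 hx y

end C0Semigroup

/-! ### Controls supported after the last impulse. -/

namespace C0Semigroup

variable {H : Type*} [NormedAddCommGroup H] [InnerProductSpace ℝ H]

@[simp] lemma solS_apply_zero (S : C0Semigroup H) (α t : ℝ) : S.solS α t 0 = 0 := by
  simp [solS]

@[simp] lemma solP_apply_zero (S : C0Semigroup H) (α t : ℝ) : S.solP α t 0 = 0 := by
  simp [solP]

end C0Semigroup

namespace FractionalImpulsiveSystem

variable {H U : Type*} [NormedAddCommGroup H] [InnerProductSpace ℝ H]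
  [NormedAddCommGroup U] [InnerProductSpace ℝ U] {n : ℕ}

lemma kernel_eq_zero (sys : FractionalImpulsiveSystem H U n) {u : ℝ → U} {s : ℝ} (hs : u s = 0)
    (τ : ℝ) : sys.kernel u τ s = 0 := by
  simp [kernel, hs]

lemma t_castSucc_last_lt (sys : FractionalImpulsiveSystem H U n) :
    sys.t (Fin.last n).castSucc < sys.b := by
  rw [← sys.t_last]
  exact sys.t_strictMono (Fin.castSucc_lt_last _)

variable {sys : FractionalImpulsiveSystem H U n} {u : ℝ → U}

lemma segment_zero_eq_zero {r : ℝ} (hu : ∀ s, s ∉ Set.Ioo r sys.b → u s = 0)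
    {k : Fin (n + 1)} {τ : ℝ} (hk : sys.t k.castSucc ≤ τ) (hτ : τ ≤ r) :
    sys.segment u k 0 τ = 0 := by
  have h : ∀ s ∈ Set.uIcc (sys.t k.castSucc) τ, sys.kernel u τ s = 0 := fun s hs => by
    rw [Set.uIcc_of_le hk] at hs
    exact sys.kernel_eq_zero (hu s fun h => by linarith [hs.2, h.1]) τ
  rw [segment, C0Semigroup.solS_apply_zero, zero_add, intervalIntegral.integral_congr h]
  simp

/-- Before `r` nothing drives the system, and the impulses map the zero state and zero discrete
control to zero. -/
lemma postState_zero_eq_zero {r : ℝ} (hr : sys.t (Fin.last n).castSucc ≤ r)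
    (hu : ∀ s, s ∉ Set.Ioo r sys.b → u s = 0) (k : Fin (n + 1)) :
    sys.postState 0 u 0 k = 0 := by
  induction k using Fin.induction with
  | zero => rfl
  | succ k ih =>
    have hstep : sys.postState 0 u 0 k.succ =
        sys.segment u k.castSucc (sys.postState 0 u 0 k.castSucc) (sys.t k.succ.castSucc)
          + sys.D k (sys.segment u k.castSucc (sys.postState 0 u 0 k.castSucc)
              (sys.t k.succ.castSucc)) + sys.E k 0 := rfl
    have hseg : sys.segment u k.castSucc 0 (sys.t k.succ.castSucc) = 0 :=
      segment_zero_eq_zero hu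
        (sys.t_strictMono.monotone (Fin.castSucc_le_castSucc_iff.mpr (Fin.castSucc_lt_succ).le))
        ((sys.t_strictMono.monotone (Fin.castSucc_le_castSucc_iff.mpr (Fin.le_last _))).trans hr)
    rw [hstep, ih, hseg]
    simp

lemma controlMap_eq_integral {r : ℝ} (hr : sys.t (Fin.last n).castSucc ≤ r)
    (hu : ∀ s, s ∉ Set.Ioo r sys.b → u s = 0) :
    sys.controlMap u 0 = ∫ s, sys.kernel u sys.b s := by
  rw [controlMap, finalState, postState_zero_eq_zero hr hu, segment,
    C0Semigroup.solS_apply_zero, zero_add,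
    intervalIntegral.integral_of_le sys.t_castSucc_last_lt.le]
  refine setIntegral_eq_integral_of_forall_compl_eq_zero fun s hs => ?_
  exact sys.kernel_eq_zero (hu s fun h => hs ⟨hr.trans_lt h.1, h.2.le⟩) _

lemma admissible_of_support {r : ℝ} (hr : sys.t (Fin.last n).castSucc ≤ r)
    (hu : ∀ s, s ∉ Set.Ioo r sys.b → u s = 0)
    (hmem : MemLp u 2 (volume.restrict (Set.Icc 0 sys.b)))
    (hint : Integrable (sys.kernel u sys.b)) : sys.Admissible u := by
  refine ⟨hmem, fun k => ?_⟩
  rcases eq_or_lt_of_le (Fin.le_last k) with rfl | hk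
  · rw [Fin.succ_last, sys.t_last]
    exact hint.intervalIntegrable
  · have hle : sys.t k.succ ≤ r := by
      refine le_trans (sys.t_strictMono.monotone ?_) hr
      exact Fin.succ_le_castSucc_iff.mpr hk
    have hk' : sys.t k.castSucc ≤ sys.t k.succ :=
      sys.t_strictMono.monotone (Fin.castSucc_lt_succ).le
    refine (intervalIntegrable_const (c := (0 : H))).congr fun s hs => ?_
    rw [Set.uIoc_of_le hk'] at hs
    exact (sys.kernel_eq_zero (hu s fun h => by linarith [hs.2, h.1]) _).symm

end FractionalImpulsiveSystem

/-! ### The subspace of terminal states and its orthogonal complement. -/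

namespace FractionalImpulsiveSystem

variable {H U : Type*} [NormedAddCommGroup H] [InnerProductSpace ℝ H]
  [NormedAddCommGroup U] [InnerProductSpace ℝ U] {n : ℕ}

variable {sys : FractionalImpulsiveSystem H U n}

/-- `solP` is a Bochner integral with default value `0`, so it is not linear by definition; `P`
supplies linearity on `(r, b)`. -/
lemma kernel_add {r : ℝ} {P : ℝ → H →ₗ[ℝ] H}
    (hP : ∀ s ∈ Set.Ioo r sys.b, ∀ y, sys.S.solP sys.α (sys.b - s) y = P s y) {u v : ℝ → U}
    (hu : ∀ s, s ∉ Set.Ioo r sys.b → u s = 0) (hv : ∀ s, s ∉ Set.Ioo r sys.b → v s = 0) :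
    sys.kernel (u + v) sys.b = sys.kernel u sys.b + sys.kernel v sys.b := by
  funext s
  by_cases hs : s ∈ Set.Ioo r sys.b
  · simp [kernel, hP s hs]
  · rw [Pi.add_apply, sys.kernel_eq_zero (hu s hs), sys.kernel_eq_zero (hv s hs),
      sys.kernel_eq_zero (by simp [hu s hs, hv s hs]), add_zero]

lemma kernel_smul {r : ℝ} {P : ℝ → H →ₗ[ℝ] H}
    (hP : ∀ s ∈ Set.Ioo r sys.b, ∀ y, sys.S.solP sys.α (sys.b - s) y = P s y) {u : ℝ → U}
    (hu : ∀ s, s ∉ Set.Ioo r sys.b → u s = 0) (a : ℝ) :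
    sys.kernel (a • u) sys.b = a • sys.kernel u sys.b := by
  funext s
  by_cases hs : s ∈ Set.Ioo r sys.b
  · simp only [kernel, Pi.smul_apply, map_smul, hP s hs]
    rw [smul_comm]
  · rw [Pi.smul_apply, sys.kernel_eq_zero (hu s hs), sys.kernel_eq_zero (by simp [hu s hs]),
      smul_zero]

/-- The states reached at the final time by controls supported in `(r, b)`, as a subspace. -/
noncomputable def terminalStates (sys : FractionalImpulsiveSystem H U n) (r : ℝ)
    (P : ℝ → H →ₗ[ℝ] H)
    (hP : ∀ s ∈ Set.Ioo r sys.b, ∀ y, sys.S.solP sys.α (sys.b - s) y = P s y) :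
    Submodule ℝ H where
  carrier := {y | ∃ u : ℝ → U, (∀ s, s ∉ Set.Ioo r sys.b → u s = 0) ∧
    MemLp u 2 (volume.restrict (Set.Icc 0 sys.b)) ∧ Integrable (sys.kernel u sys.b) ∧
    ∫ s, sys.kernel u sys.b s = y}
  zero_mem' := by
    have : sys.kernel (0 : ℝ → U) sys.b = 0 := funext fun s => sys.kernel_eq_zero rfl _
    refine ⟨0, fun _ _ => rfl, MemLp.zero, ?_, ?_⟩
    · rw [this]
      exact integrable_zero _ _ _
    · simp [this]
  add_mem' := by
    rintro _ _ ⟨u, hu, hu2, hui, rfl⟩ ⟨v, hv, hv2, hvi, rfl⟩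
    have h := kernel_add hP hu hv
    refine ⟨u + v, fun s hs => by simp [hu s hs, hv s hs], hu2.add hv2, ?_, ?_⟩
    · rw [h]
      exact hui.add hvi
    · rw [h]
      exact integral_add hui hvi
  smul_mem' := by
    rintro a _ ⟨u, hu, hu2, hui, rfl⟩
    have h := kernel_smul hP hu a
    refine ⟨a • u, fun s hs => by simp [hu s hs], hu2.const_smul a, ?_, ?_⟩
    · rw [h]
      exact hui.smul a
    · rw [h]
      exact integral_smul a _

/-- The feedback-type test control `⟪z, 𝒫_α(b - s) B w⟫ w` on `(r, b)`. -/
noncomputable def testControl (sys : FractionalImpulsiveSystem H U n) (r : ℝ) (z : H) (w : U) :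
    ℝ → U :=
  (Set.Ioo r sys.b).indicator fun s =>
    (inner ℝ z (sys.S.solP sys.α (sys.b - s) (sys.B w)) : ℝ) • w

lemma kernel_testControl {r : ℝ} {P : ℝ → H →ₗ[ℝ] H}
    (hP : ∀ s ∈ Set.Ioo r sys.b, ∀ y, sys.S.solP sys.α (sys.b - s) y = P s y) (z : H) (w : U) :
    sys.kernel (sys.testControl r z w) sys.b = (Set.Ioo r sys.b).indicator fun s =>
      ((sys.b - s) ^ (sys.α - 1)) •
        ((inner ℝ z (sys.S.solP sys.α (sys.b - s) (sys.B w)) : ℝ) •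
          sys.S.solP sys.α (sys.b - s) (sys.B w)) := by
  funext s
  by_cases hs : s ∈ Set.Ioo r sys.b
  · simp only [kernel, testControl, Set.indicator_of_mem hs, map_smul, hP s hs]
  · rw [Set.indicator_of_notMem hs, kernel_eq_zero (u := sys.testControl r z w) sys
      (Set.indicator_of_notMem hs _)]

lemma integrableOn_sub_rpow (sys : FractionalImpulsiveSystem H U n) {r : ℝ} (hr : r ≤ sys.b) :
    IntegrableOn (fun s => (sys.b - s) ^ (sys.α - 1)) (Set.Ioo r sys.b) := by
  have h := intervalIntegral.intervalIntegrable_rpow' (a := 0) (b := sys.b - r)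
    (r := sys.α - 1) (by linarith [sys.α_pos])
  have h2 := h.comp_sub_left sys.b
  rw [sub_zero, sub_sub_cancel] at h2
  exact ((intervalIntegrable_iff_integrableOn_Ioc_of_le hr).mp h2.symm).mono_set
    Set.Ioo_subset_Ioc_self

/-- A vector orthogonal to all states reached from `(r, b)` annihilates `𝒫_α(b - s) B w`. -/
lemma inner_solP_eq_zero_of_mem_orthogonal [CompleteSpace H] {r : ℝ}
    (hr : r ≤ sys.b) {P : ℝ → H →ₗ[ℝ] H}
    (hP : ∀ s ∈ Set.Ioo r sys.b, ∀ y, sys.S.solP sys.α (sys.b - s) y = P s y) {z : H}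
    (hz : z ∈ (sys.terminalStates r P hP)ᗮ) (w : U)
    (hcont : ContinuousOn (fun s => sys.S.solP sys.α (sys.b - s) (sys.B w)) (Set.Icc r sys.b)) :
    ∀ s ∈ Set.Ioo r sys.b, inner ℝ z (sys.S.solP sys.α (sys.b - s) (sys.B w)) = (0 : ℝ) := by
  set p : ℝ → H := fun s => sys.S.solP sys.α (sys.b - s) (sys.B w) with hp
  have hcont' : ContinuousOn p (Set.Ioo r sys.b) := hcont.mono Set.Ioo_subset_Icc_self
  have hinner : ContinuousOn (fun s => (inner ℝ z (p s) : ℝ)) (Set.Ioo r sys.b) :=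
    continuousOn_const.inner hcont'
  obtain ⟨M, hM⟩ := isCompact_Icc.exists_bound_of_continuousOn hcont
  have hM' : ∀ s ∈ Set.Ioo r sys.b, ‖p s‖ ≤ M := fun s hs => hM s (Set.Ioo_subset_Icc_self hs)
  have hin : ∀ s ∈ Set.Ioo r sys.b, ‖(inner ℝ z (p s) : ℝ)‖ ≤ ‖z‖ * M := fun s hs =>
    (norm_inner_le_norm _ _).trans (by gcongr; exact hM' s hs)
  have hker := kernel_testControl hP z w
  have hint : Integrable (sys.kernel (sys.testControl r z w) sys.b) := by
    rw [hker, integrable_indicator_iff measurableSet_Ioo]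
    refine (sys.integrableOn_sub_rpow hr).smul_bdd (C := ‖z‖ * M * M) ?_ ?_
    · exact (hinner.smul hcont').aestronglyMeasurable measurableSet_Ioo
    · refine (ae_restrict_iff' measurableSet_Ioo).mpr (Eventually.of_forall fun s hs => ?_)
      rw [norm_smul]
      have := hin s hs
      gcongr
      · exact (norm_nonneg _).trans this
      · exact hM' s hs
  have hmem : MemLp (sys.testControl r z w) 2 (volume.restrict (Set.Icc 0 sys.b)) := by
    have hms : AEStronglyMeasurable (sys.testControl r z w) volume :=
      (aestronglyMeasurable_indicator_iff measurableSet_Ioo).mpr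
        ((hinner.smul continuousOn_const).aestronglyMeasurable measurableSet_Ioo)
    refine MemLp.of_bound hms.restrict (‖z‖ * |M| * ‖w‖) (Eventually.of_forall fun s => ?_)
    by_cases hs : s ∈ Set.Ioo r sys.b
    · rw [testControl, Set.indicator_of_mem hs, norm_smul]
      gcongr
      exact (hin s hs).trans (by gcongr; exact le_abs_self M)
    · rw [testControl, Set.indicator_of_notMem hs, norm_zero]
      positivity
  have horth := (Submodule.mem_orthogonal' _ z).mp hz (∫ s, sys.kernel (sys.testControl r z w) sys.b s)
    ⟨_, fun s hs => Set.indicator_of_notMem hs _, hmem, hint, rfl⟩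
  -- Orthogonality to this state becomes the vanishing of the integral of a nonnegative function,
  -- the square `⟪z, p s⟫²` with a positive weight.
  rw [← integral_inner hint] at horth
  have hform : ∀ s, inner ℝ z (sys.kernel (sys.testControl r z w) sys.b s) =
      (Set.Ioo r sys.b).indicator
        (fun s => (sys.b - s) ^ (sys.α - 1) * (inner ℝ z (p s) : ℝ) ^ 2) s := fun s => by
    rw [hker]
    by_cases hs : s ∈ Set.Ioo r sys.b
    · simp only [Set.indicator_of_mem hs, real_inner_smul_right, hp]
      ring
    · simp [Set.indicator_of_notMem hs]
  have hint2 := hint.const_inner (𝕜 := ℝ) z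
  simp_rw [hform] at horth hint2
  rw [integral_indicator measurableSet_Ioo, setIntegral_eq_zero_iff_of_nonneg_ae] at horth
  · refine Measure.eqOn_open_of_ae_eq (μ := volume) (U := Set.Ioo r sys.b) ?_ isOpen_Ioo hinner
      (continuousOn_const (c := (0 : ℝ)))
    filter_upwards [horth, ae_restrict_mem measurableSet_Ioo] with s hs hsI
    have hpos : 0 < (sys.b - s) ^ (sys.α - 1) := Real.rpow_pos_of_pos (sub_pos.mpr hsI.2) _
    simpa [hpos.ne'] using hs
  · refine (ae_restrict_iff' measurableSet_Ioo).mpr (Eventually.of_forall fun s hs => ?_)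
    have := Real.rpow_nonneg (sub_nonneg.mpr hs.2.le) (sys.α - 1)
    simp only [Pi.zero_apply]
    positivity
  · exact (integrable_indicator_iff measurableSet_Ioo).mp hint2

end FractionalImpulsiveSystem

/-! ### The density theorem. -/

theorem mainTheorem2 {H U : Type*} [NormedAddCommGroup H] [InnerProductSpace ℝ H]
    [CompleteSpace H] [NormedAddCommGroup U] [InnerProductSpace ℝ U] [CompleteSpace U]
    {n : ℕ} (sys : FractionalImpulsiveSystem H U n) (A : H →L[ℝ] H)
    (hA : sys.A = (A : H →ₗ[ℝ] H).toPMap ⊤)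
    (hspan : (Submodule.span ℝ {y : H | ∃ (m : ℕ) (w : U), (A ^ m) (sys.B w) = y}).topologicalClosure
      = ⊤) :
    sys.ApproximatelyControllable := by
  have hgen := sys.isGenerator
  rw [hA] at hgen
  have hα := sys.α_pos
  obtain ⟨κ, ρ, hρ, hκ, hsum⟩ := sys.S.exists_hasSum_solP hgen hα sys.α_le_one
  set T := sys.t (Fin.last n).castSucc with hT
  have hTb : T < sys.b := sys.t_castSucc_last_lt
  -- The first bound keeps `(r, b)` after the last impulse; the second keeps `t^α ≤ ρ/2`, strictly
  -- inside the radius, where continuity holds.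
  set ε := min (sys.b - T) ((ρ / 2) ^ sys.α⁻¹) with hε
  have hε0 : 0 < ε := lt_min (sub_pos.mpr hTb) (by positivity)
  have hερ : ∀ t, 0 ≤ t → t ≤ ε → t ^ sys.α ≤ ρ / 2 := fun t ht htε => by
    calc t ^ sys.α ≤ ((ρ / 2) ^ sys.α⁻¹) ^ sys.α := by
          gcongr
          exact htε.trans (min_le_right _ _)
      _ = ρ / 2 := Real.rpow_inv_rpow (by positivity) hα.ne'
  set r := sys.b - ε with hr
  have hTr : T ≤ r := by linarith [min_le_left (sys.b - T) ((ρ / 2) ^ sys.α⁻¹)]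
  have hrb : r ≤ sys.b := by linarith
  have hsum' : ∀ s ∈ Set.Ioo r sys.b, ∀ y, HasSum
      (fun m : ℕ => ((sys.b - s) ^ sys.α) ^ m • (κ m • (A ^ m) y))
      (sys.S.solP sys.α (sys.b - s) y) := fun s hs y => by
    have h0 : 0 ≤ sys.b - s := by linarith [hs.2]
    exact hsum _ h0 ((hερ _ h0 (by linarith [hs.1])).trans (by linarith)) y
  -- Linearity comes from uniqueness of sums in the expansion; the value `0` outside `(r, b)` is
  -- never used.
  let P : ℝ → H →ₗ[ℝ] H := fun s => if hs : s ∈ Set.Ioo r sys.b then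
    { toFun := fun y => sys.S.solP sys.α (sys.b - s) y
      map_add' := fun x y => by
        refine (hsum' s hs (x + y)).unique ?_
        simpa [smul_add] using (hsum' s hs x).add (hsum' s hs y)
      map_smul' := fun a x => by
        refine (hsum' s hs (a • x)).unique ?_
        convert! (hsum' s hs x).const_smul a using 2 with m
        simp only [map_smul]
        rw [smul_comm (κ m) a, smul_comm _ a] } else 0
  have hP : ∀ s ∈ Set.Ioo r sys.b, ∀ y, sys.S.solP sys.α (sys.b - s) y = P s y :=
    fun s hs y => by simp only [P, dif_pos hs]; rfl
  have hdense : (sys.terminalStates r P hP).topologicalClosure = ⊤ := by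
    rw [Submodule.topologicalClosure_eq_top_iff, Submodule.eq_bot_iff]
    intro z hz
    have hcoeff : ∀ (w : U) (m : ℕ), inner ℝ z ((A ^ m) (sys.B w)) = (0 : ℝ) := by
      intro w m
      -- The substitution `x = t^α` turns the fractional expansion into an ordinary power series.
      set G : ℝ → H := fun x => sys.S.solP sys.α (x ^ sys.α⁻¹) (sys.B w) with hG
      have hGsum : ∀ x ∈ Set.Icc 0 ρ,
          HasSum (fun m : ℕ => x ^ m • (κ m • (A ^ m) (sys.B w))) (G x) := fun x hx => by
        have h1 : (x ^ sys.α⁻¹) ^ sys.α = x := Real.rpow_inv_rpow hx.1 hα.ne'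
        have h2 := hsum (x ^ sys.α⁻¹) (Real.rpow_nonneg hx.1 _) (h1.le.trans hx.2) (sys.B w)
        rwa [h1] at h2
      have hcont : ContinuousOn (fun s => sys.S.solP sys.α (sys.b - s) (sys.B w))
          (Set.Icc r sys.b) := by
        have h3 : ContinuousOn (fun s => G ((sys.b - s) ^ sys.α)) (Set.Icc r sys.b) := by
          refine (continuousOn_of_hasSum_pow_smul hρ hGsum).comp
            (ContinuousOn.rpow_const (by fun_prop) fun s _ => Or.inr hα.le) fun s hs => ?_
          have h0 : 0 ≤ sys.b - s := sub_nonneg.mpr hs.2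
          exact ⟨Real.rpow_nonneg h0 _,
            (hερ _ h0 (by linarith [hs.1])).trans_lt (by linarith)⟩
        refine h3.congr fun s hs => ?_
        simp only [hG, Real.rpow_rpow_inv (sub_nonneg.mpr hs.2) hα.ne']
      have hzero := FractionalImpulsiveSystem.inner_solP_eq_zero_of_mem_orthogonal hrb hP hz w hcont
      have hfreq : ∃ᶠ x in 𝓝[>] 0, inner ℝ z (G x) = (0 : ℝ) := by
        refine Eventually.frequently ?_
        filter_upwards [Ioo_mem_nhdsGT (Real.rpow_pos_of_pos hε0 sys.α)] with x hx
        have h4 : x ^ sys.α⁻¹ < ε := by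
          rw [← Real.rpow_rpow_inv hε0.le hα.ne']
          exact Real.rpow_lt_rpow hx.1.le hx.2 (inv_pos.mpr hα)
        have h5 : 0 < x ^ sys.α⁻¹ := Real.rpow_pos_of_pos hx.1 _
        have h6 := hzero (sys.b - x ^ sys.α⁻¹) ⟨by linarith, by linarith⟩
        rwa [sub_sub_cancel] at h6
      have h7 := inner_coeff_eq_zero_of_hasSum hρ hGsum hfreq m
      rw [real_inner_smul_right] at h7
      exact (mul_eq_zero.mp h7).resolve_left (hκ m)
    have hbot := Submodule.topologicalClosure_eq_top_iff.mp hspan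
    have hzmem : z ∈ (Submodule.span ℝ
        {y : H | ∃ (m : ℕ) (w : U), (A ^ m) (sys.B w) = y})ᗮ := by
      rw [Submodule.mem_orthogonal']
      intro y hy
      induction hy using Submodule.span_induction with
      | mem y hy => obtain ⟨m, w, rfl⟩ := hy; exact hcoeff w m
      | zero => exact inner_zero_right z
      | add x y _ _ hx hy => rw [inner_add_right, hx, hy, add_zero]
      | smul a x _ hx => rw [real_inner_smul_right, hx, mul_zero]
    rw [hbot] at hzmem
    exact (Submodule.mem_bot ℝ).mp hzmem
  -- Density of this subspace suffices; the full image is not needed as a subspace.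
  have hsub : (sys.terminalStates r P hP : Set H) ⊆
      {y : H | ∃ (u : ℝ → U) (v : Fin n → U), sys.Admissible u ∧ sys.controlMap u v = y} := by
    rintro y ⟨u, hu, hmem, hint, rfl⟩
    exact ⟨u, 0, FractionalImpulsiveSystem.admissible_of_support hTr hu hmem hint,
      FractionalImpulsiveSystem.controlMap_eq_integral hTr hu⟩
  refine Set.eq_univ_of_univ_subset ?_
  have h8 := congrArg (fun K : Submodule ℝ H => (K : Set H)) hdense
  simp only [Submodule.topologicalClosure_coe, Submodule.top_coe] at h8
  rw [← h8]
  exact closure_mono hsub
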